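/- Let $n\ge 1$, let $\mathbb B^n$ be the open unit ball of $\mathbb C^n$, and let $\mathcal H(\mathbb B^n)$ be the space of holomorphic functions on $\mathbb B^n$. For $\alpha>-1$ let $d\nu_\alpha(z)=c_\alpha(1-|z|^2)^\alpha\,d\nu(z)$, where $\nu$ is Lebesgue measure on $\mathbb B^n$ and $c_\alpha$ is chosen so that $\nu_\alpha(\mathbb B^n)=1$. For $0<p<\infty$, the weighted Bergman space $A^p_\alpha(\mathbb B^n)$ consists of all $f\in\mathcal H(\mathbb B^n)$ with $$\|f\|_{p,\alpha}=\Big(\int_{\mathbb B^n}|f|^p\,d\nu_\alpha\Big)^{1/p}<\infty .$$ A function $g\in\mathcal H(\mathbb B^n)$ is a multiplier from $A^p_\alpha(\mathbb B^n)$ to $A^q_\beta(\mathbb B^n)$ if there is a constant $C>0$ such that, for every $f\in A^p_\alpha(\mathbb B^n)$, one has $fg\in A^q_\beta(\mathbb B^n)$ and $\|fg\|_{q,\beta}\le C\|f\|_{p,\alpha}$; the set of these multipliers is denoted $\mathcal M(A^p_\alpha(\mathbb B^n),A^q_\beta(\mathbb B^n))$. For $s\ge 1$, the $s$-Bloch space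 $\mathcal B^s$ consists of all $f\in\mathcal H(\mathbb B^n)$ with $\sup_{z\in\mathbb B^n}(1-|z|)^{s}|Rf(z)|<\infty$, where $Rf(z)=\sum_{j=1}^n z_j\frac{\partial f}{\partial z_j}(z)$, and $H^\infty(\mathbb B^n)$ is the space of bounded holomorphic functions on $\mathbb B^n$. Let $0<p\le q<\infty$, let $\alpha,\beta>-1$, and put $\lambda=\frac{n+1+\beta}{q}-\frac{n+1+\alpha}{p}$. Then the following equalities of sets of holomorphic functions hold: (i) if $\lambda>0$, then $\mathcal M(A^p_\alpha(\mathbb B^n),A^q_\beta(\mathbb B^n))=\mathcal B^{\lambda+1}$; (ii) if $\lambda=0$, then $\mathcal M(A^p_\alpha(\mathbb B^n),A^q_\beta(\mathbb B^n))=H^\infty(\mathbb B^n)$; (iii) if $\lambda<0$, then $\mathcal M(A^p_\alpha(\mathbb B^n),A^q_\beta(\mathbb B^n))=\{0\}$. -/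

import Mathlib

open MeasureTheory Metric

/-- The open unit ball `𝔹ⁿ` of `ℂⁿ` (Euclidean norm), as a set. -/
abbrev cBall (n : ℕ) : Set (EuclideanSpace ℂ (Fin n)) :=
  Metric.ball (0 : EuclideanSpace ℂ (Fin n)) 1

/-- Extension by zero to `ℂⁿ` of a function on the ball. -/
noncomputable def extZero {n : ℕ} (f : cBall n → ℂ) : EuclideanSpace ℂ (Fin n) → ℂ :=
  Function.extend Subtype.val f 0

theorem extZero_apply {n : ℕ} (f : cBall n → ℂ) (z : cBall n) : extZero f z = f z :=
  Subtype.val_injective.extend_apply f 0 z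

theorem extZero_of_mem {n : ℕ} (f : cBall n → ℂ) {z : EuclideanSpace ℂ (Fin n)}
    (hz : z ∈ cBall n) : extZero f z = f ⟨z, hz⟩ :=
  extZero_apply f ⟨z, hz⟩

/-- The algebra `𝓗(𝔹ⁿ)` of holomorphic functions on the open unit ball. -/
noncomputable def Hol (n : ℕ) : Subalgebra ℂ (cBall n → ℂ) where
  carrier := {f | DifferentiableOn ℂ (extZero f) (cBall n)}
  mul_mem' := by
    intro f g hf hg
    refine (DifferentiableOn.mul hf hg).congr fun z hz => ?_
    simp [extZero_of_mem _ hz]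
  add_mem' := by
    intro f g hf hg
    refine (DifferentiableOn.add hf hg).congr fun z hz => ?_
    simp [extZero_of_mem _ hz]
  algebraMap_mem' := by
    intro c
    refine (differentiableOn_const c).congr fun z hz => ?_
    simp [extZero_of_mem _ hz]

/-- The normalized weighted measure `dν_α(z) = c_α (1 - |z|²)^α dν(z)` on the ball, viewed as a
measure on `ℂⁿ` carried by the ball; `c_α` is the reciprocal of the total mass. -/
noncomputable def bergmanMeasure (n : ℕ) (α : ℝ) : Measure (EuclideanSpace ℂ (Fin n)) :=
  (∫⁻ z in cBall n, ENNReal.ofReal ((1 - ‖z‖ ^ 2) ^ α))⁻¹ •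
    (volume.restrict (cBall n)).withDensity fun z => ENNReal.ofReal ((1 - ‖z‖ ^ 2) ^ α)

/-- The (quasi-)norm `‖f‖_{p,α} = (∫_{𝔹ⁿ} |f|^p dν_α)^{1/p}`, for `0 < p < ∞`. -/
noncomputable def bergmanNorm {n : ℕ} (p α : ℝ) (f : Hol n) : ℝ :=
  (eLpNorm (extZero f.1) (ENNReal.ofReal p) (bergmanMeasure n α)).toReal

/-- The weighted Bergman space `A^p_α(𝔹ⁿ)`: holomorphic functions with
`∫_{𝔹ⁿ} |f|^p dν_α < ∞`. -/
def BergmanSpace (n : ℕ) (p α : ℝ) : Set (Hol n) :=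
  {f | MemLp (extZero f.1) (ENNReal.ofReal p) (bergmanMeasure n α)}

/-- The multipliers between two spaces `X`, `Y` of holomorphic functions on the ball, with gauges
`NX`, `NY` (distance to `0`): the holomorphic `g` for which there is a `C > 0` such that, for every
`f ∈ X`, the product `f g` is in `Y` and `NY (f g) ≤ C * NX f`. -/
def Multipliers {n : ℕ} (X : Set (Hol n)) (NX : Hol n → ℝ) (Y : Set (Hol n)) (NY : Hol n → ℝ) :
    Set (Hol n) :=
  {g | ∃ C : ℝ, 0 < C ∧ ∀ f ∈ X, f * g ∈ Y ∧ NY (f * g) ≤ C * NX f}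

/-- The multipliers `𝓜(A^p_α(𝔹ⁿ), A^q_β(𝔹ⁿ))`. -/
def BergmanMultipliers (n : ℕ) (p α q β : ℝ) : Set (Hol n) :=
  Multipliers (BergmanSpace n p α) (bergmanNorm p α) (BergmanSpace n q β) (bergmanNorm q β)

/-- The radial derivative `R f (z) = ∑ⱼ zⱼ ∂f/∂zⱼ (z)`. -/
noncomputable def radialDeriv {n : ℕ} (f : Hol n) (z : cBall n) : ℂ :=
  ∑ j : Fin n, (z : EuclideanSpace ℂ (Fin n)) j *
    fderiv ℂ (extZero f.1) z (EuclideanSpace.single j 1)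

/-- The space `Λ_ω(𝔹ⁿ)`, for `ω : (0,1] → (0,∞)`: holomorphic functions with
`sup_z (1 - |z|) |R f (z)| / ω (1 - |z|) < ∞`. -/
def LambdaSpace (n : ℕ) (ω : ℝ → ℝ) : Set (Hol n) :=
  {f | BddAbove (Set.range fun z : cBall n =>
    (1 - ‖(z : EuclideanSpace ℂ (Fin n))‖) * ‖radialDeriv f z‖ /
      ω (1 - ‖(z : EuclideanSpace ℂ (Fin n))‖))}

/-- The `s`-Bloch space `𝓑^s = Λ_ω` with `ω t = t ^ (1 - s)`, i.e. the holomorphic functions with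
`sup_z (1 - |z|)^s |R f (z)| < ∞`. -/
noncomputable def BlochSpace (n : ℕ) (s : ℝ) : Set (Hol n) :=
  LambdaSpace n fun t => t ^ (1 - s)

/-- The space `H^∞(𝔹ⁿ)` of bounded holomorphic functions. -/
def HInfty (n : ℕ) : Set (Hol n) :=
  {f | BddAbove (Set.range fun z : cBall n => ‖f.1 z‖)}

/-! All three cases follow from one identity, `bergmanMultipliers_eq_growthSpace`: the multipliers
are exactly the holomorphic $g$ with $|g(z)|\le C(1-|z|)^{-\lambda}$. Write $M_\alpha=n+1+\alpha$.

Sufficiency: point evaluation gives $|f(z)|\le C\|f\|_{p,\alpha}(1-|z|)^{-M_\alpha/p}$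
(`exists_norm_le_bergmanNorm`). As $p\le q$, write $|f|^q=|f|^p|f|^{q-p}$ and estimate only the
second factor pointwise; together with the growth of $g$ the powers of $1-|z|$ add up to
$\alpha-\beta$, which turns the weight of $\nu_\beta$ into that of $\nu_\alpha$.

Necessity: test on $k_a(z)=(1-\langle z,a\rangle)^{-2M_\alpha/p}$, of norm at most
$C(1-|a|)^{-M_\alpha/p}$ by `exists_lintegral_kernel_le`, and apply point evaluation in the target
space to $k_ag$ at $a$ itself.

The growth condition is then identified: for $\lambda>0$ it is the Bloch condition (Cauchy estimates
one way, radial integration the other), for $\lambda=0$ boundedness, and for $\lambda<0$ the maximum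
principle forces $g=0$.

Both integral estimates rest on ellipsoids of size $\delta$ along a unit vector $\zeta$ and
$\sqrt\delta$ across it: their volume is of order $\delta^{n+1}$, which is where $n+1$ comes from.
-/

/-! ### Sub-mean value inequality for $|F|^p$ -/

/-- Tangent-line bound $u\le e^{u-1}$ at $u=p\log x$, sharp when $x^p=e$. It stands in for Jensen's
convexity inequality when passing from $\log|h|$ to $|h|^p$. -/
theorem exp_one_mul_log_le_rpow {p x : ℝ} (hp : 0 < p) (hx : 0 ≤ x) :
    Real.exp 1 * (p * Real.log x) ≤ x ^ p := by
  rcases hx.eq_or_lt with rfl | hx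
  · simp [Real.zero_rpow hp.ne']
  · have h := Real.add_one_le_exp (p * Real.log x - 1)
    rw [Real.rpow_def_of_pos hx, mul_comm (Real.log x) p]
    calc Real.exp 1 * (p * Real.log x) ≤ Real.exp 1 * Real.exp (p * Real.log x - 1) := by
          gcongr; linarith
      _ = Real.exp (p * Real.log x) := by rw [← Real.exp_add]; ring_nf

/-- Jensen's formula yields the subharmonicity of `log ‖h‖`. -/
theorem log_norm_le_circleAverage {h : ℂ → ℂ} (hh : AnalyticOnNhd ℂ h (closedBall 0 1))
    (h0 : h 0 ≠ 0) : Real.log ‖h 0‖ ≤ Real.circleAverage (fun z => Real.log ‖h z‖) 0 1 := by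
  have hh' : AnalyticOnNhd ℂ h (closedBall 0 |(1 : ℝ)|) := by simpa using hh
  -- What remains is the sum over the zeros $u$ in the closed disc of multiplicity times
  -- $\log(1/|u|)$, whose terms are nonnegative.
  rw [hh'.circleAverage_log_norm one_ne_zero h0, le_add_iff_nonneg_left]
  refine finsum_nonneg fun u => ?_
  by_cases hu : u ∈ closedBall (0 : ℂ) |(1 : ℝ)|
  · refine mul_nonneg ?_ ?_
    · exact_mod_cast (MeromorphicOn.AnalyticOnNhd.divisor_nonneg hh') u
    · simp only [zero_sub, norm_neg, one_mul, Real.log_inv, neg_nonneg]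
      exact Real.log_nonpos (norm_nonneg _) (by simpa using hu)
  · rw [Function.locallyFinsuppWithin.apply_eq_zero_of_notMem _ hu]; simp

theorem norm_rpow_le_circleAverage {h : ℂ → ℂ} (hh : AnalyticOnNhd ℂ h (closedBall 0 1))
    {p : ℝ} (hp : 0 < p) : ‖h 0‖ ^ p ≤ Real.circleAverage (fun z => ‖h z‖ ^ p) 0 1 := by
  by_cases h0 : h 0 = 0
  · rw [h0, norm_zero, Real.zero_rpow hp.ne']
    exact Real.circleAverage_nonneg_of_nonneg fun z _ => by positivity
  -- This scaling makes $|k(0)|^p=e$, the equality case of `exp_one_mul_log_le_rpow`, so nothing is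
  -- lost at the centre.
  set s : ℝ := ‖h 0‖ * Real.exp (-(1 / p)) with hs
  have hspos : 0 < s := by positivity
  set k : ℂ → ℂ := fun z => (s : ℂ)⁻¹ * h z with hk
  have hkn : ∀ z, ‖k z‖ = s⁻¹ * ‖h z‖ := fun z => by simp [hk, abs_of_pos hspos]
  have hka : AnalyticOnNhd ℂ k (closedBall 0 1) := analyticOnNhd_const.mul hh
  have hk0 : k 0 ≠ 0 := mul_ne_zero (by simpa using hspos.ne') h0
  have hk0n : ‖k 0‖ = Real.exp (1 / p) := by
    rw [hkn, hs, Real.exp_neg]; field_simp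
  have hint : CircleIntegrable (fun z => ‖h z‖ ^ p) 0 1 := by
    refine ContinuousOn.circleIntegrable zero_le_one ?_
    exact (hh.continuousOn.mono sphere_subset_closedBall).norm.rpow_const
      fun _ _ => Or.inr hp.le
  have hintk : CircleIntegrable (fun z => Real.log ‖k z‖) 0 1 := by
    refine MeromorphicOn.circleIntegrable_log_norm ?_
    exact (hka.mono (by simpa using sphere_subset_closedBall)).meromorphicOn
  have key := log_norm_le_circleAverage hka hk0
  rw [hk0n, Real.log_exp] at key
  have hmono : Real.circleAverage (fun z => (Real.exp 1 * p) • Real.log ‖k z‖) 0 1 ≤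
      Real.circleAverage (fun z => (s⁻¹ ^ p) • ‖h z‖ ^ p) 0 1 := by
    refine Real.circleAverage_mono (hintk.const_fun_smul) (hint.const_fun_smul) fun z _ => ?_
    have := exp_one_mul_log_le_rpow hp (norm_nonneg (k z))
    rw [hkn z, Real.mul_rpow (by positivity) (by positivity), ← hkn z] at this
    simpa [mul_assoc] using this
  rw [Real.circleAverage_fun_smul, Real.circleAverage_fun_smul] at hmono
  have h1 : Real.exp 1 ≤ s⁻¹ ^ p * Real.circleAverage (fun z => ‖h z‖ ^ p) 0 1 := by
    refine le_trans ?_ hmono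
    calc Real.exp 1 = Real.exp 1 * p * (1 / p) := by field_simp
      _ ≤ _ := by rw [smul_eq_mul]; gcongr
  have h2 : s⁻¹ ^ p = Real.exp 1 * (‖h 0‖ ^ p)⁻¹ := by
    rw [hs, mul_inv, ← Real.exp_neg, neg_neg, Real.mul_rpow (by positivity) (by positivity),
      ← Real.exp_mul, one_div_mul_cancel hp.ne', Real.inv_rpow (by positivity), mul_comm]
  rw [h2, mul_assoc] at h1
  have h3 : 1 ≤ (‖h 0‖ ^ p)⁻¹ * Real.circleAverage (fun z => ‖h z‖ ^ p) 0 1 :=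
    le_of_mul_le_mul_left (by simpa using h1) (Real.exp_pos 1)
  have h4 : 0 < ‖h 0‖ ^ p := Real.rpow_pos_of_pos (norm_pos_iff.2 h0) p
  rwa [inv_mul_eq_div, le_div_iff₀ h4, one_mul] at h3

theorem enorm_rpow_le_lintegral_circle {h : ℂ → ℂ} (hh : AnalyticOnNhd ℂ h (closedBall 0 1))
    {p : ℝ} (hp : 0 < p) : ‖h 0‖ₑ ^ p * ENNReal.ofReal (2 * Real.pi) ≤
      ∫⁻ θ in Set.Ioc 0 (2 * Real.pi), ‖h (circleMap 0 1 θ)‖ₑ ^ p := by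
  have hint : CircleIntegrable (fun z => ‖h z‖ ^ p) 0 1 := by
    refine ContinuousOn.circleIntegrable zero_le_one ?_
    exact (hh.continuousOn.mono sphere_subset_closedBall).norm.rpow_const
      fun _ _ => Or.inr hp.le
  have hpi : (0 : ℝ) < 2 * Real.pi := by positivity
  have key := norm_rpow_le_circleAverage hh hp
  rw [Real.circleAverage_def, smul_eq_mul, inv_mul_eq_div, le_div_iff₀ hpi,
    intervalIntegral.integral_of_le hpi.le] at key
  have hint' := (intervalIntegrable_iff_integrableOn_Ioc_of_le hpi.le).1 hint
  have e : ∀ z : ℂ, ‖z‖ₑ ^ p = ENNReal.ofReal (‖z‖ ^ p) := fun z => by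
    rw [← ofReal_norm, ENNReal.ofReal_rpow_of_nonneg (norm_nonneg _) hp.le]
  simp_rw [e]
  rw [← ENNReal.ofReal_mul (by positivity), ← ofReal_integral_eq_lintegral_ofReal hint'
    (Filter.Eventually.of_forall fun θ => by positivity)]
  exact ENNReal.ofReal_le_ofReal key

/-- Multiplication by a unimodular scalar, as a real-linear isometry of `ℂⁿ`. -/
noncomputable def unimodularSMul (n : ℕ) (c : ℂ) (hc : ‖c‖ = 1) :
    EuclideanSpace ℂ (Fin n) ≃ₗᵢ[ℝ] EuclideanSpace ℂ (Fin n) where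
  toFun z := c • z
  invFun z := c⁻¹ • z
  map_add' := smul_add c
  map_smul' r z := smul_comm c r z
  left_inv z := inv_smul_smul₀ (by rintro rfl; simp at hc) z
  right_inv z := smul_inv_smul₀ (by rintro rfl; simp at hc) z
  norm_map' z := by
    change ‖c • z‖ = ‖z‖
    rw [norm_smul, hc, one_mul]

/-- Sub-mean value inequality for `‖F‖ ^ p` on the unit ball of `ℂⁿ`. -/
theorem enorm_rpow_mul_volume_le_lintegral_ball {n : ℕ} {F : EuclideanSpace ℂ (Fin n) → ℂ}
    (hF : DifferentiableOn ℂ F (cBall n)) {p : ℝ} (hp : 0 < p) :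
    ‖F 0‖ₑ ^ p * volume (cBall n) ≤ ∫⁻ w in cBall n, ‖F w‖ₑ ^ p := by
  have hpi : (0 : ℝ) < 2 * Real.pi := by positivity
  have hpi0 : ENNReal.ofReal (2 * Real.pi) ≠ 0 := by simpa using hpi
  have hnc : ∀ θ, ‖circleMap 0 1 θ‖ = 1 := fun θ => by simp
  set G : EuclideanSpace ℂ (Fin n) → ENNReal := (cBall n).indicator fun w => ‖F w‖ₑ ^ p with hG
  have hGm : Measurable G := by
    classical
    rw [hG, ← Set.piecewise_eq_indicator]
    exact ContinuousOn.measurable_piecewise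
      (ENNReal.continuous_rpow_const.comp_continuousOn hF.continuousOn.enorm)
      continuousOn_const measurableSet_ball
  -- The integral over the ball is unchanged by $w\mapsto e^{i\theta}w$, so it may be averaged over
  -- $\theta$ and estimated on each complex line through $0$.
  have hrot : ∀ θ, ∫⁻ w, G (circleMap 0 1 θ • w) = ∫⁻ w, G w := fun θ =>
    (LinearIsometryEquiv.measurePreserving (unimodularSMul n _ (hnc θ))).lintegral_comp hGm
  have hGint : ∫⁻ w, G w = ∫⁻ w in cBall n, ‖F w‖ₑ ^ p := lintegral_indicator measurableSet_ball _
  have hmem : ∀ (θ : ℝ) w, w ∈ cBall n → circleMap 0 1 θ • w ∈ cBall n := fun θ w hw => by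
    simpa [norm_smul] using hw
  have hslice : ∀ w ∈ cBall n, ‖F 0‖ₑ ^ p * ENNReal.ofReal (2 * Real.pi) ≤
      ∫⁻ θ in Set.Ioc 0 (2 * Real.pi), G (circleMap 0 1 θ • w) := by
    intro w hw
    have hw1 : ‖w‖ < 1 := by simpa using hw
    have hopen : IsOpen {c : ℂ | c • w ∈ cBall n} :=
      isOpen_ball.preimage (continuous_id.smul continuous_const)
    have hd : DifferentiableOn ℂ (fun c : ℂ => F (c • w)) {c : ℂ | c • w ∈ cBall n} :=
      hF.comp (by fun_prop) fun c hc => hc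
    have ha : AnalyticOnNhd ℂ (fun c : ℂ => F (c • w)) (closedBall 0 1) := by
      refine (hd.analyticOnNhd hopen).mono fun c hc => ?_
      have : ‖c‖ ≤ 1 := by simpa using hc
      simp only [Set.mem_ofPred_eq, mem_ball_zero_iff, norm_smul]
      nlinarith [norm_nonneg w]
    have := enorm_rpow_le_lintegral_circle ha hp
    simp only [zero_smul] at this
    refine this.trans_eq (lintegral_congr fun θ => ?_)
    rw [hG, Set.indicator_of_mem (hmem θ w hw)]
  have hswap : ∫⁻ θ in Set.Ioc 0 (2 * Real.pi), ∫⁻ w, G (circleMap 0 1 θ • w) =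
      ∫⁻ w, ∫⁻ θ in Set.Ioc 0 (2 * Real.pi), G (circleMap 0 1 θ • w) := by
    refine lintegral_lintegral_swap ?_
    refine (hGm.comp ?_).aemeasurable
    have : Continuous fun x : ℝ × EuclideanSpace ℂ (Fin n) => circleMap 0 1 x.1 • x.2 := by
      fun_prop
    exact this.measurable
  have h1 : (‖F 0‖ₑ ^ p * volume (cBall n)) * ENNReal.ofReal (2 * Real.pi) ≤
      (∫⁻ w in cBall n, ‖F w‖ₑ ^ p) * ENNReal.ofReal (2 * Real.pi) := by
    calc _ = ∫⁻ w in cBall n, ‖F 0‖ₑ ^ p * ENNReal.ofReal (2 * Real.pi) := by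
          rw [setLIntegral_const]; ring
      _ ≤ ∫⁻ w in cBall n, ∫⁻ θ in Set.Ioc 0 (2 * Real.pi), G (circleMap 0 1 θ • w) :=
          setLIntegral_mono' measurableSet_ball hslice
      _ ≤ ∫⁻ w, ∫⁻ θ in Set.Ioc 0 (2 * Real.pi), G (circleMap 0 1 θ • w) :=
          setLIntegral_le_lintegral _ _
      _ = ∫⁻ θ in Set.Ioc 0 (2 * Real.pi), ∫⁻ w, G (circleMap 0 1 θ • w) := hswap.symm
      _ = _ := by simp_rw [hrot, hGint]; rw [setLIntegral_const]; simp
  exact (ENNReal.mul_le_mul_iff_left hpi0 ENNReal.ofReal_ne_top).1 h1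

/-! ### Non-isotropic dilations and their Jacobians -/

theorem exists_norm_eq_one_smul_eq {n : ℕ} (hn : 1 ≤ n) (a : EuclideanSpace ℂ (Fin n)) :
    ∃ ζ : EuclideanSpace ℂ (Fin n), ‖ζ‖ = 1 ∧ a = (‖a‖ : ℂ) • ζ := by
  by_cases ha : a = 0
  · exact ⟨EuclideanSpace.single ⟨0, hn⟩ 1, by simp, by simp [ha]⟩
  · have ha' : (‖a‖ : ℂ) ≠ 0 := by simpa using ha
    refine ⟨(‖a‖ : ℂ)⁻¹ • a, ?_, (smul_inv_smul₀ ha' a).symm⟩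
    rw [norm_smul, norm_inv, Complex.norm_real, norm_norm, inv_mul_cancel₀ (by simpa using ha)]

/-- The non-isotropic dilation of `ℂⁿ`, with factor `σ ^ 2` in the direction of the unit vector `ζ`
and factor `σ` in the orthogonal directions. -/
noncomputable def anisoDilation {n : ℕ} (ζ : EuclideanSpace ℂ (Fin n)) (σ : ℝ) :
    EuclideanSpace ℂ (Fin n) →ₗ[ℂ] EuclideanSpace ℂ (Fin n) :=
  (σ : ℂ) • LinearMap.transvection (((σ : ℂ) - 1) • (innerSL ℂ ζ).toLinearMap) ζ

section anisoDilation
variable {n : ℕ} {ζ : EuclideanSpace ℂ (Fin n)}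

theorem anisoDilation_apply (σ : ℝ) (w : EuclideanSpace ℂ (Fin n)) :
    anisoDilation ζ σ w = (σ : ℂ) • (w + (((σ : ℂ) - 1) * inner ℂ ζ w) • ζ) := by
  simp [anisoDilation, LinearMap.transvection.apply]

theorem inner_self_of_norm_eq_one (hζ : ‖ζ‖ = 1) : inner ℂ ζ ζ = 1 := by
  rw [inner_self_eq_norm_sq_to_K, hζ]; simp

theorem inner_anisoDilation (hζ : ‖ζ‖ = 1) (σ : ℝ)
    (w : EuclideanSpace ℂ (Fin n)) : inner ℂ ζ (anisoDilation ζ σ w) = (σ : ℂ) ^ 2 * inner ℂ ζ w := by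
  rw [anisoDilation_apply, inner_smul_right, inner_add_right, inner_smul_right,
    inner_self_of_norm_eq_one hζ]
  ring

theorem norm_sq_anisoDilation (hζ : ‖ζ‖ = 1) (σ : ℝ)
    (w : EuclideanSpace ℂ (Fin n)) : ‖anisoDilation ζ σ w‖ ^ 2 =
    σ ^ 2 * (‖w‖ ^ 2 - (1 - σ ^ 2) * ‖inner ℂ ζ w‖ ^ 2) := by
  rw [anisoDilation_apply, norm_smul, mul_pow, Complex.norm_real, Real.norm_eq_abs, sq_abs,
    norm_add_sq (𝕜 := ℂ), inner_smul_right, norm_smul, hζ, norm_mul, ← inner_conj_symm w ζ]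
  have h1 : ((σ : ℂ) - 1) * inner ℂ ζ w * (starRingEnd ℂ) (inner ℂ ζ w) =
      (((σ - 1) * ‖inner ℂ ζ w‖ ^ 2 : ℝ) : ℂ) := by
    rw [mul_assoc, Complex.mul_conj, Complex.normSq_eq_norm_sq]; push_cast; ring
  have h2 : ‖(σ : ℂ) - 1‖ ^ 2 = (σ - 1) ^ 2 := by
    rw [← Complex.ofReal_one, ← Complex.ofReal_sub, Complex.norm_real, Real.norm_eq_abs, sq_abs]
  rw [h1, mul_one, mul_pow, h2]
  simp only [RCLike.re_to_complex, Complex.ofReal_re]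
  ring

/-- The complex determinant is $\sigma^n$ from the scalar factor times $\sigma$ from the
transvection; the real determinant is its squared modulus. -/
theorem det_anisoDilation (hζ : ‖ζ‖ = 1) (σ : ℝ) : LinearMap.det ((anisoDilation ζ σ).restrictScalars ℝ) =
    (σ ^ 2) ^ (n + 1) := by
  rw [LinearMap.det_restrictScalars, anisoDilation, LinearMap.det_smul, LinearMap.transvection.det]
  have h : 1 + (((σ : ℂ) - 1) • (innerSL ℂ ζ).toLinearMap) ζ = σ := by
    simp [hζ]
  rw [h, finrank_euclideanSpace_fin, ← pow_succ, map_pow, Algebra.norm_complex_apply,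
    Complex.normSq_ofReal, sq]

theorem anisoDilation_anisoDilation_inv (hζ : ‖ζ‖ = 1) {σ : ℝ} (hσ : σ ≠ 0)
    (w : EuclideanSpace ℂ (Fin n)) :
    anisoDilation ζ σ (anisoDilation ζ σ⁻¹ w) = w := by
  have hσ' : (σ : ℂ) ≠ 0 := by exact_mod_cast hσ
  rw [anisoDilation_apply σ, inner_anisoDilation hζ, anisoDilation_apply]
  push_cast
  simp only [smul_add, smul_smul]
  rw [mul_inv_cancel₀ hσ', one_smul, add_assoc, ← add_smul]
  convert add_zero w using 2
  convert zero_smul ℂ ζ using 2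
  field_simp
  ring

/-- Change of variables under the affine map with linear part `anisoDilation ζ σ`. -/
theorem lintegral_comp_add_anisoDilation (hζ : ‖ζ‖ = 1) {σ : ℝ} (hσ : σ ≠ 0)
    (a : EuclideanSpace ℂ (Fin n))
    {G : EuclideanSpace ℂ (Fin n) → ENNReal} (hG : Measurable G) :
    ENNReal.ofReal ((σ ^ 2) ^ (n + 1)) * ∫⁻ w, G (a + anisoDilation ζ σ w) = ∫⁻ w, G w := by
  have hdet := det_anisoDilation hζ σ
  have hpos : 0 < (σ ^ 2) ^ (n + 1) := by positivity
  have hm : Measurable ((anisoDilation ζ σ).restrictScalars ℝ) :=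
    (LinearMap.continuous_of_finiteDimensional _).measurable
  have h1 : ∫⁻ w, G (a + anisoDilation ζ σ w) =
      ∫⁻ y, G (a + y) ∂(Measure.map ((anisoDilation ζ σ).restrictScalars ℝ) volume) := by
    rw [lintegral_map (f := fun y => G (a + y)) (hG.comp (measurable_const_add a)) hm]; rfl
  rw [h1, Measure.map_linearMap_addHaar_eq_smul_addHaar _ (by rw [hdet]; exact hpos.ne'), hdet,
    lintegral_smul_measure, lintegral_add_left_eq_self, smul_eq_mul, ← mul_assoc, abs_inv,
    abs_of_pos hpos, ← ENNReal.ofReal_mul hpos.le, mul_inv_cancel₀ hpos.ne', ENNReal.ofReal_one,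
    one_mul]

theorem volume_image_anisoDilation (hζ : ‖ζ‖ = 1) (σ : ℝ) (a : EuclideanSpace ℂ (Fin n))
    (s : Set (EuclideanSpace ℂ (Fin n))) :
    volume ((fun w => a + anisoDilation ζ σ w) '' s) =
      ENNReal.ofReal ((σ ^ 2) ^ (n + 1)) * volume s := by
  have h := Measure.addHaar_image_linearMap volume ((anisoDilation ζ σ).restrictScalars ℝ) s
  rw [det_anisoDilation hζ, abs_of_nonneg (by positivity)] at h
  rw [← h, ← Set.image_image (fun y => a + y) (anisoDilation ζ σ)]
  simp only [Set.image_add_left, measure_preimage_add]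
  rfl

end anisoDilation

/-! ### Weights on ellipsoids and point evaluations -/

/-- The unnormalized Bergman weight `(1 - |z|²)^α`. -/
noncomputable def bergmanWeight {n : ℕ} (α : ℝ) (z : EuclideanSpace ℂ (Fin n)) : ENNReal :=
  ENNReal.ofReal ((1 - ‖z‖ ^ 2) ^ α)

theorem measurable_bergmanWeight {n : ℕ} (α : ℝ) :
    Measurable (bergmanWeight α : EuclideanSpace ℂ (Fin n) → ENNReal) := by
  unfold bergmanWeight; fun_prop

theorem measurable_indicator_ball_of_continuousOn {n : ℕ} {G : EuclideanSpace ℂ (Fin n) → ENNReal}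
    (hG : ContinuousOn G (cBall n)) : Measurable ((cBall n).indicator G) := by
  classical
  rw [← Set.piecewise_eq_indicator]
  exact ContinuousOn.measurable_piecewise hG continuousOn_const measurableSet_ball

/-- On `[t/2, 3t]`, the function `x ^ α` is comparable to `t ^ α`. -/
theorem min_rpow_mul_rpow_le {α t x : ℝ} (ht : 0 < t) (h1 : t / 2 ≤ x) (h2 : x ≤ 3 * t) :
    min ((1 / 2 : ℝ) ^ α) (3 ^ α) * t ^ α ≤ x ^ α := by
  have hx : 0 < x := by linarith
  rcases le_total 0 α with hα | hα
  · calc _ ≤ (1 / 2 : ℝ) ^ α * t ^ α := by gcongr; exact min_le_left _ _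
      _ = (1 / 2 * t) ^ α := (Real.mul_rpow (by norm_num) ht.le).symm
      _ ≤ x ^ α := Real.rpow_le_rpow (by positivity) (by linarith) hα
  · calc _ ≤ (3 : ℝ) ^ α * t ^ α := by gcongr; exact min_le_right _ _
      _ = (3 * t) ^ α := (Real.mul_rpow (by norm_num) ht.le).symm
      _ ≤ x ^ α := Real.rpow_le_rpow_of_nonpos hx h2 hα

theorem norm_sq_smul_add_anisoDilation {n : ℕ} {ζ : EuclideanSpace ℂ (Fin n)} (hζ : ‖ζ‖ = 1)
    (r σ : ℝ) (w : EuclideanSpace ℂ (Fin n)) :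
    ‖(r : ℂ) • ζ + anisoDilation ζ σ w‖ ^ 2 = r ^ 2 + 2 * r * σ ^ 2 * (inner ℂ ζ w).re +
      σ ^ 2 * (‖w‖ ^ 2 - (1 - σ ^ 2) * ‖inner ℂ ζ w‖ ^ 2) := by
  rw [norm_add_sq (𝕜 := ℂ), norm_sq_anisoDilation hζ, inner_smul_left, inner_anisoDilation hζ,
    norm_smul, hζ, Complex.norm_real, mul_one, Real.norm_eq_abs, sq_abs, Complex.conj_ofReal,
    ← Complex.ofReal_pow, ← mul_assoc, ← Complex.ofReal_mul]
  simp only [RCLike.re_to_complex, Complex.re_ofReal_mul]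
  ring

theorem norm_inner_le_of_norm_eq_one {n : ℕ} {ζ : EuclideanSpace ℂ (Fin n)} (hζ : ‖ζ‖ = 1)
    (w : EuclideanSpace ℂ (Fin n)) : ‖inner ℂ ζ w‖ ≤ ‖w‖ := by
  simpa [hζ] using norm_inner_le_norm (𝕜 := ℂ) ζ w

/-- On the ellipsoid `r ζ + T(𝔹)`, with `T` the dilation with `σ ^ 2 = (1 - r) / 6`, the quantity
`1 - |z|²` is comparable to `1 - r`. -/
theorem one_sub_norm_sq_ellipsoid {n : ℕ} {ζ : EuclideanSpace ℂ (Fin n)} (hζ : ‖ζ‖ = 1)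
    {r σ : ℝ} (hr : 0 ≤ r) (hr1 : r < 1) (hσ : σ ^ 2 = (1 - r) / 6)
    {w : EuclideanSpace ℂ (Fin n)} (hw : ‖w‖ < 1) :
    (1 - r) / 2 ≤ 1 - ‖(r : ℂ) • ζ + anisoDilation ζ σ w‖ ^ 2 ∧
      1 - ‖(r : ℂ) • ζ + anisoDilation ζ σ w‖ ^ 2 ≤ 3 * (1 - r) := by
  rw [norm_sq_smul_add_anisoDilation hζ, hσ]
  have h1 := norm_inner_le_of_norm_eq_one hζ w
  have h2 := Complex.abs_re_le_norm (inner ℂ ζ w)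
  have h3 := abs_le.1 (h2.trans (h1.trans hw.le))
  set x := (inner ℂ ζ w).re
  set y := ‖inner ℂ ζ w‖
  have hy : 0 ≤ y := norm_nonneg _
  have hw0 := norm_nonneg w
  have hA : 0 ≤ (1 - (1 - r) / 6) * y ^ 2 := mul_nonneg (by linarith) (by positivity)
  have hA' : (1 - (1 - r) / 6) * y ^ 2 ≤ ‖w‖ ^ 2 := by nlinarith
  have hB : ‖w‖ ^ 2 ≤ 1 := by nlinarith
  -- The cross term is at most $2\sigma^2=(1-r)/3$ and the quadratic term lies between $0$ and
  -- $\sigma^2=(1-r)/6$. Together they use at most $(1-r)/2$, which explains the $6$; then $1-r\le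
  -- 1-r^2\le 2(1-r)$ gives both bounds.
  have hC : |2 * r * ((1 - r) / 6) * x| ≤ 2 * ((1 - r) / 6) := by
    rw [abs_mul, abs_of_nonneg (by positivity [sub_pos.2 hr1])]
    have : |x| ≤ 1 := abs_le.2 h3
    have h5 : 0 ≤ (1 - r) / 6 := by linarith
    calc 2 * r * ((1 - r) / 6) * |x| ≤ 2 * 1 * ((1 - r) / 6) * 1 := by gcongr
      _ = _ := by ring
  have hC' := abs_le.1 hC
  have hD : (1 - r) / 6 * (‖w‖ ^ 2 - (1 - (1 - r) / 6) * y ^ 2) ≤ (1 - r) / 6 * 1 := by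
    gcongr; linarith
  have hE : 0 ≤ (1 - r) / 6 * (‖w‖ ^ 2 - (1 - (1 - r) / 6) * y ^ 2) :=
    mul_nonneg (by linarith) (by linarith)
  constructor <;> nlinarith

/-- Point evaluations on the weighted Bergman spaces. -/
theorem exists_pointEval_le {n : ℕ} (hn : 1 ≤ n) {p : ℝ} (hp : 0 < p) (α : ℝ) :
    ∃ C : ENNReal, C ≠ ⊤ ∧ ∀ f : EuclideanSpace ℂ (Fin n) → ℂ, DifferentiableOn ℂ f (cBall n) →
      ∀ a ∈ cBall n, ENNReal.ofReal ((1 - ‖a‖) ^ ((n : ℝ) + 1 + α)) * ‖f a‖ₑ ^ p ≤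
        C * ∫⁻ z in cBall n, ‖f z‖ₑ ^ p * bergmanWeight α z := by
  set κ : ℝ := min ((1 / 2 : ℝ) ^ α) (3 ^ α) with hκ
  have hκ0 : 0 < κ := lt_min (by positivity) (by positivity)
  set V : ENNReal := volume (cBall n) with hV
  have hV0 : V ≠ 0 := (measure_ball_pos _ _ one_pos).ne'
  have hVt : V ≠ ⊤ := measure_ball_lt_top.ne
  refine ⟨ENNReal.ofReal (6 ^ (n + 1) / κ) * V⁻¹,
    ENNReal.mul_ne_top ENNReal.ofReal_ne_top (ENNReal.inv_ne_top.2 hV0), fun f hf a ha => ?_⟩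
  obtain ⟨ζ, hζ, haζ⟩ := exists_norm_eq_one_smul_eq hn a
  set r := ‖a‖ with hr
  have hr0 : 0 ≤ r := norm_nonneg a
  have hr1 : r < 1 := by simpa using ha
  have hr2 : 0 < 1 - r := by linarith
  set σ := Real.sqrt ((1 - r) / 6) with hσd
  have hσ : σ ^ 2 = (1 - r) / 6 := Real.sq_sqrt (by linarith)
  have hσ0 : σ ≠ 0 := by intro h; rw [h] at hσ; linarith
  have hell := fun w (hw : w ∈ cBall n) =>
    one_sub_norm_sq_ellipsoid hζ hr0 hr1 hσ (w := w) (by simpa using hw)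
  rw [← haζ] at hell
  have hmaps : ∀ w ∈ cBall n, a + anisoDilation ζ σ w ∈ cBall n := fun w hw => by
    rw [mem_ball_zero_iff]
    nlinarith [(hell w hw).1, norm_nonneg (a + anisoDilation ζ σ w)]
  have hTd : Differentiable ℂ fun w => a + anisoDilation ζ σ w :=
    (LinearMap.toContinuousLinearMap (anisoDilation ζ σ)).differentiable.const_add a
  -- The sub-mean value inequality is applied after an affine change of variables, hence on an
  -- ellipsoid about $a$ of volume comparable to $(1-|a|)^{n+1}$. A Euclidean ball of radius
  -- comparable to $1-|a|$ would only give the exponent $2n$.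
  have hsub := enorm_rpow_mul_volume_le_lintegral_ball
    (hf.comp hTd.differentiableOn hmaps) hp
  simp only [Function.comp, map_zero, add_zero] at hsub
  set H : EuclideanSpace ℂ (Fin n) → ENNReal :=
    (cBall n).indicator fun z => ‖f z‖ₑ ^ p * bergmanWeight α z with hH
  have hHm : Measurable H := by
    have h1 : H = fun z => (cBall n).indicator (fun z => ‖f z‖ₑ ^ p) z * bergmanWeight α z := by
      funext z; rw [hH, Set.indicator_mul_left]
    rw [h1]
    exact (measurable_indicator_ball_of_continuousOn (ENNReal.continuous_rpow_const.comp_continuousOn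
      hf.continuousOn.enorm)).mul (measurable_bergmanWeight α)
  have hHint : ∫⁻ z, H z = ∫⁻ z in cBall n, ‖f z‖ₑ ^ p * bergmanWeight α z :=
    lintegral_indicator measurableSet_ball _
  have hcv := lintegral_comp_add_anisoDilation hζ hσ0 a hHm
  rw [hHint, hσ] at hcv
  have hstep : ENNReal.ofReal (κ * (1 - r) ^ α) * (‖f a‖ₑ ^ p * V) ≤
      ∫⁻ w, H (a + anisoDilation ζ σ w) := by
    calc _ ≤ ENNReal.ofReal (κ * (1 - r) ^ α) *
          ∫⁻ w in cBall n, ‖f (a + anisoDilation ζ σ w)‖ₑ ^ p := by gcongr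
      _ = ∫⁻ w in cBall n, ENNReal.ofReal (κ * (1 - r) ^ α) *
          ‖f (a + anisoDilation ζ σ w)‖ₑ ^ p :=
        (lintegral_const_mul' _ _ ENNReal.ofReal_ne_top).symm
      _ ≤ ∫⁻ w in cBall n, H (a + anisoDilation ζ σ w) := by
        refine setLIntegral_mono' measurableSet_ball fun w hw => ?_
        rw [hH, Set.indicator_of_mem (hmaps w hw), mul_comm]
        gcongr
        exact ENNReal.ofReal_le_ofReal
          (min_rpow_mul_rpow_le hr2 (hell w hw).1 (hell w hw).2)
      _ ≤ _ := setLIntegral_le_lintegral _ _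
  have hexp : (1 - r) ^ ((n : ℝ) + 1 + α) =
      6 ^ (n + 1) / κ * (((1 - r) / 6) ^ (n + 1) * (κ * (1 - r) ^ α)) := by
    rw [Real.rpow_add hr2, div_pow]
    have : (1 - r) ^ ((n : ℝ) + 1) = (1 - r) ^ (n + 1) := by exact_mod_cast Real.rpow_natCast _ _
    rw [this]
    field_simp
  calc ENNReal.ofReal ((1 - r) ^ ((n : ℝ) + 1 + α)) * ‖f a‖ₑ ^ p
      = ENNReal.ofReal ((1 - r) ^ ((n : ℝ) + 1 + α)) * ‖f a‖ₑ ^ p * (V * V⁻¹) := by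
        rw [ENNReal.mul_inv_cancel hV0 hVt, mul_one]
    _ = ENNReal.ofReal (6 ^ (n + 1) / κ) * V⁻¹ * (ENNReal.ofReal (((1 - r) / 6) ^ (n + 1)) *
        (ENNReal.ofReal (κ * (1 - r) ^ α) * (‖f a‖ₑ ^ p * V))) := by
        rw [hexp, ENNReal.ofReal_mul (by positivity), ENNReal.ofReal_mul (by positivity)]
        ring
    _ ≤ ENNReal.ofReal (6 ^ (n + 1) / κ) * V⁻¹ * (ENNReal.ofReal (((1 - r) / 6) ^ (n + 1)) *
        ∫⁻ w, H (a + anisoDilation ζ σ w)) := by gcongr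
    _ = _ := by rw [hcv]

theorem lintegral_bergmanWeight_lt_top {n : ℕ} (hn : 1 ≤ n) {α : ℝ} (hα : -1 < α) :
    ∫⁻ z in cBall n, bergmanWeight α z < ⊤ := by
  have : Nonempty (Fin n) := ⟨⟨0, hn⟩⟩
  have hint : IntegrableOn (fun z : EuclideanSpace ℂ (Fin n) => (1 - ‖z‖ ^ 2) ^ α) (cBall n) := by
    refine (integrableOn_fun_norm_addHaar volume (f := fun y : ℝ => (1 - y ^ 2) ^ α)).2 ?_
    have h0 : IntervalIntegrable (fun y : ℝ => (1 - y) ^ α) volume 0 1 := by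
      have := (intervalIntegral.intervalIntegrable_rpow' (a := 0) (b := 1) hα).comp_sub_left 1
      simpa using this.symm
    have h1 : IntegrableOn (fun y : ℝ => (1 - y) ^ α) (Set.Icc 0 1) :=
      (intervalIntegrable_iff_integrableOn_Icc_of_le zero_le_one).1 h0
    -- In polar coordinates only the factor $(1-y)^\alpha$ is singular; the others are continuous on
    -- $[0,1]$.
    have h2 : IntegrableOn (fun y : ℝ => (y ^ (Module.finrank ℝ (EuclideanSpace ℂ (Fin n)) - 1) *
        (1 + y) ^ α) * (1 - y) ^ α) (Set.Icc 0 1) := by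
      refine h1.continuousOn_mul ?_ isCompact_Icc
      refine ContinuousOn.mul (by fun_prop) ?_
      exact ContinuousOn.rpow_const (by fun_prop) fun y hy => Or.inl (by linarith [hy.1])
    refine (h2.mono_set Set.Ioo_subset_Icc_self).congr_fun (fun y hy => ?_) measurableSet_Ioo
    have e : 1 - y ^ 2 = (1 + y) * (1 - y) := by ring
    simp only [smul_eq_mul]
    rw [e, Real.mul_rpow (by linarith [hy.1]) (by linarith [hy.2]), mul_assoc]
  exact hint.lintegral_lt_top

theorem lintegral_bergmanWeight_ne_zero (n : ℕ) (α : ℝ) :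
    ∫⁻ z in cBall n, bergmanWeight α z ≠ 0 := by
  rw [← pos_iff_ne_zero]
  refine (setLIntegral_pos_iff (measurable_bergmanWeight α)).2 ?_
  refine (measure_ball_pos volume (0 : EuclideanSpace ℂ (Fin n)) one_pos).trans_le
    (measure_mono fun z hz => ⟨?_, hz⟩)
  have hz1 : ‖z‖ < 1 := by simpa using hz
  have : 0 < 1 - ‖z‖ ^ 2 := by nlinarith [norm_nonneg z]
  simpa [bergmanWeight, Function.mem_support] using Real.rpow_pos_of_pos this α

/-! ### Weighted volume of Carleson regions -/

theorem norm_sub_ofReal_smul_sq {n : ℕ} {ζ : EuclideanSpace ℂ (Fin n)} (hζ : ‖ζ‖ = 1) (t : ℝ)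
    (z : EuclideanSpace ℂ (Fin n)) :
    ‖z - (t : ℂ) • ζ‖ ^ 2 = ‖z‖ ^ 2 - 2 * t * (inner ℂ ζ z).re + t ^ 2 := by
  rw [norm_sub_sq (𝕜 := ℂ), inner_smul_right, norm_smul, hζ, Complex.norm_real, mul_one,
    Real.norm_eq_abs, sq_abs, ← inner_conj_symm z ζ]
  simp only [RCLike.re_to_complex, Complex.re_ofReal_mul, Complex.conj_re]
  ring

/-- The part of the unit ball where `|1 - ⟨z, ζ⟩| < δ`. -/
def carlesonRegion {n : ℕ} (ζ : EuclideanSpace ℂ (Fin n)) (δ : ℝ) :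
    Set (EuclideanSpace ℂ (Fin n)) :=
  {z | ‖z‖ < 1 ∧ ‖1 - inner ℂ ζ z‖ < δ}

theorem measurableSet_carlesonRegion {n : ℕ} (ζ : EuclideanSpace ℂ (Fin n)) (δ : ℝ) :
    MeasurableSet (carlesonRegion ζ δ) := by
  have h : IsOpen (carlesonRegion ζ δ) :=
    (isOpen_lt continuous_norm continuous_const).inter
      (isOpen_lt (by fun_prop : Continuous fun z : EuclideanSpace ℂ (Fin n) =>
        ‖1 - inner ℂ ζ z‖) continuous_const)
  exact h.measurableSet

/-- On a translate in direction `ζ`, the weight is controlled by a power of the distance to the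
boundary point of the line. -/
theorem one_sub_norm_sq_rpow_le {n : ℕ} {ζ z : EuclideanSpace ℂ (Fin n)} (hζ : ‖ζ‖ = 1) (α : ℝ)
    {δ t : ℝ} (hδ : δ ≤ 1 / 2) (hz : z - (t : ℂ) • ζ ∈ carlesonRegion ζ δ) :
    let s := t + (Real.sqrt (1 - ‖z‖ ^ 2 + (inner ℂ ζ z).re ^ 2) - (inner ℂ ζ z).re)
    s ∈ Set.Ioo 0 δ ∧ (1 - ‖z - (t : ℂ) • ζ‖ ^ 2) ^ α ≤ 2 ^ |α| * s ^ α := by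
  intro s
  obtain ⟨h1, h2⟩ := hz
  rw [inner_sub_right, inner_smul_right, inner_self_of_norm_eq_one hζ, mul_one] at h2
  have h3 := (Complex.re_le_norm _).trans_lt h2
  simp only [Complex.sub_re, Complex.one_re, Complex.ofReal_re] at h3
  have hn2 : ‖z - (t : ℂ) • ζ‖ ^ 2 < 1 := by nlinarith [norm_nonneg (z - (t : ℂ) • ζ)]
  have hx : (inner ℂ ζ z).re ^ 2 ≤ ‖z‖ ^ 2 := by
    rw [sq_le_sq, abs_norm]
    exact (Complex.abs_re_le_norm _).trans (norm_inner_le_of_norm_eq_one hζ z)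
  rw [norm_sub_ofReal_smul_sq hζ] at hn2 ⊢
  set x := (inner ℂ ζ z).re
  set D := 1 - ‖z‖ ^ 2 + x ^ 2 with hD
  have hDx : (x - t) ^ 2 < D := by rw [hD]; linarith
  have hD0 : 0 ≤ D := (sq_nonneg _).trans hDx.le
  have hsq : Real.sqrt D ^ 2 = D := Real.sq_sqrt hD0
  have hs1 : Real.sqrt D ≤ 1 := Real.sqrt_le_one.2 (by linarith)
  have hs0 := Real.sqrt_nonneg D
  have hlt : x - t < Real.sqrt D := Real.lt_sqrt_of_sq_lt hDx
  have hs : s = Real.sqrt D - (x - t) := by simp only [s]; ring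
  have hspos : 0 < s := by rw [hs]; linarith
  refine ⟨⟨hspos, by rw [hs]; linarith⟩, ?_⟩
  -- Difference of squares $D-(x-t)^2$. The first factor lies in $[1,2]$ because $1-\delta<x-t<\sqrt
  -- D\le 1$ and $\delta\le 1/2$, so the weight is comparable to $s^\alpha$.
  have hfac : 1 - (‖z‖ ^ 2 - 2 * t * x + t ^ 2) = (Real.sqrt D + (x - t)) * s := by
    rw [hs]; nlinarith
  have hu1 : 1 ≤ Real.sqrt D + (x - t) := by linarith
  rw [hfac, Real.mul_rpow (by linarith) hspos.le]
  gcongr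
  calc (Real.sqrt D + (x - t)) ^ α ≤ (Real.sqrt D + (x - t)) ^ |α| :=
        Real.rpow_le_rpow_of_exponent_le hu1 (le_abs_self α)
    _ ≤ 2 ^ |α| := Real.rpow_le_rpow (by linarith) (by linarith) (abs_nonneg α)

theorem lintegral_Ioo_rpow {α : ℝ} (hα : -1 < α) {δ : ℝ} (hδ : 0 < δ) :
    ∫⁻ s in Set.Ioo 0 δ, ENNReal.ofReal (s ^ α) = ENNReal.ofReal (δ ^ (α + 1) / (α + 1)) := by
  have hI : IntervalIntegrable (fun s : ℝ => s ^ α) volume 0 δ :=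
    intervalIntegral.intervalIntegrable_rpow' hα
  have hI' := ((intervalIntegrable_iff_integrableOn_Ioc_of_le hδ.le).1 hI).mono_set
    Set.Ioo_subset_Ioc_self
  rw [← ofReal_integral_eq_lintegral_ofReal hI', ← integral_Ioc_eq_integral_Ioo,
    ← intervalIntegral.integral_of_le hδ.le, integral_rpow (Or.inl hα),
    Real.zero_rpow (by linarith), sub_zero]
  filter_upwards [ae_restrict_mem measurableSet_Ioo] with s hs
  exact Real.rpow_nonneg hs.1.le α

/-- The parameter $s$ of `one_sub_norm_sq_rpow_le` differs from $t$ by a constant depending only on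
$z$, so translation invariance reduces the line integral to $\int_0^\delta s^\alpha\,ds$. -/
theorem lintegral_line_carlesonRegion_le {n : ℕ} {ζ : EuclideanSpace ℂ (Fin n)} (hζ : ‖ζ‖ = 1)
    {α : ℝ} (hα : -1 < α) {δ : ℝ} (hδ0 : 0 < δ) (hδ : δ ≤ 1 / 2) (z : EuclideanSpace ℂ (Fin n)) :
    ∫⁻ t : ℝ, (carlesonRegion ζ δ).indicator (bergmanWeight α) (z - (t : ℂ) • ζ) ≤
      ENNReal.ofReal (2 ^ |α| * (δ ^ (α + 1) / (α + 1))) := by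
  set c := Real.sqrt (1 - ‖z‖ ^ 2 + (inner ℂ ζ z).re ^ 2) - (inner ℂ ζ z).re with hc
  set φ : ℝ → ENNReal := (Set.Ioo 0 δ).indicator fun s => ENNReal.ofReal (2 ^ |α| * s ^ α) with hφ
  calc _ ≤ ∫⁻ t : ℝ, φ (t + c) := by
        refine lintegral_mono fun t => ?_
        by_cases ht : z - (t : ℂ) • ζ ∈ carlesonRegion ζ δ
        · obtain ⟨h1, h2⟩ := one_sub_norm_sq_rpow_le hζ α hδ ht
          rw [hφ, Set.indicator_of_mem h1, Set.indicator_of_mem ht]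
          exact ENNReal.ofReal_le_ofReal h2
        · rw [Set.indicator_of_notMem ht]
          exact zero_le
    _ = ∫⁻ s, φ s := lintegral_add_right_eq_self φ c
    _ = ∫⁻ s in Set.Ioo 0 δ, ENNReal.ofReal (2 ^ |α|) * ENNReal.ofReal (s ^ α) := by
        rw [hφ, lintegral_indicator measurableSet_Ioo]
        exact lintegral_congr fun s => ENNReal.ofReal_mul (by positivity)
    _ = _ := by
        rw [lintegral_const_mul' _ _ ENNReal.ofReal_ne_top, lintegral_Ioo_rpow hα hδ0,
          ENNReal.ofReal_mul (by positivity)]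

/-- Translates of the region `carlesonRegion ζ δ` in direction `ζ` stay in an ellipsoid. -/
theorem mem_image_anisoDilation_of_sub_mem {n : ℕ} {ζ : EuclideanSpace ℂ (Fin n)} (hζ : ‖ζ‖ = 1)
    {δ t : ℝ} (hδ0 : 0 < δ) (ht : t ∈ Set.Icc 0 δ) {z : EuclideanSpace ℂ (Fin n)}
    (hz : z - (t : ℂ) • ζ ∈ carlesonRegion ζ δ) :
    z ∈ (fun w => ζ + anisoDilation ζ (Real.sqrt δ) w) '' ball 0 3 := by
  set σ := Real.sqrt δ with hσd
  have hσ : σ ^ 2 = δ := Real.sq_sqrt hδ0.le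
  have hσ0 : 0 < σ := Real.sqrt_pos.2 hδ0
  set y := z - (t : ℂ) • ζ with hy
  obtain ⟨h1, h2⟩ := hz
  have hre : 1 - (inner ℂ ζ y).re < δ := by
    simpa using (Complex.re_le_norm _).trans_lt h2
  have hin : inner ℂ ζ (y - ζ) = -(1 - inner ℂ ζ y) := by
    rw [inner_sub_right, inner_self_of_norm_eq_one hζ]; ring
  -- Here $|y-\zeta|^2=|y|^2+1-2\,\mathrm{Re}\langle y,\zeta\rangle\le 2(1-\mathrm{Re}\langle
  -- y,\zeta\rangle)$. After rescaling, $y-\zeta$ has norm at most $\sqrt3<2$ and $t\zeta$ norm at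
  -- most $1$, whence the radius $3$.
  have hnorm : ‖y - ζ‖ ^ 2 ≤ 2 * δ := by
    have := norm_sub_ofReal_smul_sq hζ 1 y
    rw [Complex.ofReal_one, one_smul] at this
    nlinarith [norm_nonneg y]
  have hA : ‖anisoDilation ζ σ⁻¹ (y - ζ)‖ ^ 2 ≤ 3 := by
    rw [norm_sq_anisoDilation hζ, hin, norm_neg, inv_pow, hσ]
    have h3 : ‖1 - inner ℂ ζ y‖ ^ 2 ≤ δ ^ 2 := by gcongr
    have h4 : -(1 - δ⁻¹) * ‖1 - inner ℂ ζ y‖ ^ 2 ≤ δ := by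
      calc -(1 - δ⁻¹) * ‖1 - inner ℂ ζ y‖ ^ 2 ≤ δ⁻¹ * ‖1 - inner ℂ ζ y‖ ^ 2 := by
            gcongr; linarith
        _ ≤ δ⁻¹ * δ ^ 2 := by gcongr
        _ = δ := by field_simp
    calc _ ≤ δ⁻¹ * (3 * δ) := by gcongr; linarith
      _ = 3 := by field_simp
  have hB : ‖anisoDilation ζ σ⁻¹ ((t : ℂ) • ζ)‖ ≤ 1 := by
    have h5 : ‖anisoDilation ζ σ⁻¹ ((t : ℂ) • ζ)‖ ^ 2 ≤ 1 := by
      rw [norm_sq_anisoDilation hζ, inner_smul_right, inner_self_of_norm_eq_one hζ, norm_smul, hζ,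
        mul_one, mul_one, Complex.norm_real, Real.norm_eq_abs, sq_abs, inv_pow, hσ]
      have h6 : t ^ 2 ≤ δ ^ 2 := by have := ht.1; gcongr; exact ht.2
      calc δ⁻¹ * (t ^ 2 - (1 - δ⁻¹) * t ^ 2) = δ⁻¹ * δ⁻¹ * t ^ 2 := by ring
        _ ≤ δ⁻¹ * δ⁻¹ * δ ^ 2 := by gcongr
        _ = 1 := by field_simp
    exact (sq_le_one_iff₀ (norm_nonneg _)).1 h5
  refine ⟨anisoDilation ζ σ⁻¹ (z - ζ), ?_, ?_⟩
  · have hz' : z - ζ = (y - ζ) + (t : ℂ) • ζ := by rw [hy]; abel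
    rw [mem_ball_zero_iff, hz', map_add]
    have hA' : ‖anisoDilation ζ σ⁻¹ (y - ζ)‖ < 2 := by nlinarith
    linarith [norm_add_le (anisoDilation ζ σ⁻¹ (y - ζ)) (anisoDilation ζ σ⁻¹ ((t : ℂ) • ζ))]
  · simp only [anisoDilation_anisoDilation_inv hζ hσ0.ne', add_sub_cancel]

/-- Averaging over the translations $t\zeta$, $0\le t\le\delta$, avoids explicit slicing
coordinates. After Tonelli, the inner integral is $O(\delta^{\alpha+1})$ and vanishes off an
ellipsoid of volume $O(\delta^{n+1})$; dividing by $\delta$, the length of the averaging interval,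
leaves $\delta^{n+1+\alpha}$. -/
theorem lintegral_carlesonRegion_le_of_le_half {n : ℕ} {ζ : EuclideanSpace ℂ (Fin n)}
    (hζ : ‖ζ‖ = 1) {α : ℝ} (hα : -1 < α) {δ : ℝ} (hδ0 : 0 < δ) (hδ : δ ≤ 1 / 2) :
    ∫⁻ z in carlesonRegion ζ δ, bergmanWeight α z ≤
      ENNReal.ofReal (2 ^ |α| / (α + 1)) * volume (ball (0 : EuclideanSpace ℂ (Fin n)) 3) *
        ENNReal.ofReal (δ ^ ((n : ℝ) + 1 + α)) := by
  set H : EuclideanSpace ℂ (Fin n) → ENNReal :=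
    (carlesonRegion ζ δ).indicator (bergmanWeight α) with hH
  have hHm : Measurable H :=
    (measurable_bergmanWeight α).indicator (measurableSet_carlesonRegion ζ δ)
  have hHint : ∫⁻ z, H z = ∫⁻ z in carlesonRegion ζ δ, bergmanWeight α z :=
    lintegral_indicator (measurableSet_carlesonRegion ζ δ) _
  set K : Set (EuclideanSpace ℂ (Fin n)) :=
    (fun w => ζ + anisoDilation ζ (Real.sqrt δ) w) '' ball 0 3 with hK
  set B := ENNReal.ofReal (2 ^ |α| * (δ ^ (α + 1) / (α + 1))) with hB
  have hpt : ∀ z, ∫⁻ t in Set.Icc 0 δ, H (z - (t : ℂ) • ζ) ≤ K.indicator (fun _ => B) z := by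
    intro z
    by_cases hz : z ∈ K
    · rw [Set.indicator_of_mem hz]
      exact (setLIntegral_le_lintegral _ _).trans
        (lintegral_line_carlesonRegion_le hζ hα hδ0 hδ z)
    · rw [Set.indicator_of_notMem hz, nonpos_iff_eq_zero]
      refine (setLIntegral_congr_fun measurableSet_Icc fun t ht => ?_).trans lintegral_zero
      exact Set.indicator_of_notMem
        (fun h => hz (mem_image_anisoDilation_of_sub_mem hζ hδ0 ht h)) _
  have hswap : ∫⁻ t in Set.Icc 0 δ, ∫⁻ z, H (z - (t : ℂ) • ζ) =
      ∫⁻ z, ∫⁻ t in Set.Icc 0 δ, H (z - (t : ℂ) • ζ) := by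
    refine lintegral_lintegral_swap (hHm.comp ?_).aemeasurable
    exact (by fun_prop : Continuous fun x : ℝ × EuclideanSpace ℂ (Fin n) =>
      x.2 - (x.1 : ℂ) • ζ).measurable
  have hvol : volume K = ENNReal.ofReal (δ ^ (n + 1)) *
      volume (ball (0 : EuclideanSpace ℂ (Fin n)) 3) := by
    rw [hK, volume_image_anisoDilation hζ, Real.sq_sqrt hδ0.le]
  have hmain : ENNReal.ofReal δ * ∫⁻ z, H z ≤ B * volume K := by
    calc ENNReal.ofReal δ * ∫⁻ z, H z = ∫⁻ t in Set.Icc 0 δ, ∫⁻ z, H (z - (t : ℂ) • ζ) := by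
          simp_rw [lintegral_sub_right_eq_self]
          rw [setLIntegral_const, Real.volume_Icc, sub_zero, mul_comm]
      _ ≤ ∫⁻ z, K.indicator (fun _ => B) z := hswap.trans_le (lintegral_mono hpt)
      _ ≤ B * volume K := lintegral_indicator_const_le _ _
  have hexp : 2 ^ |α| * (δ ^ (α + 1) / (α + 1)) * δ ^ (n + 1) =
      δ * (2 ^ |α| / (α + 1) * δ ^ ((n : ℝ) + 1 + α)) := by
    rw [Real.rpow_add hδ0 _ α, Real.rpow_add hδ0 α 1, Real.rpow_one]
    have : δ ^ ((n : ℝ) + 1) = δ ^ (n + 1) := by exact_mod_cast Real.rpow_natCast _ _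
    rw [this]; ring
  have hα1 : 0 < α + 1 := by linarith
  have hBK : B * volume K = ENNReal.ofReal δ * (ENNReal.ofReal (2 ^ |α| / (α + 1)) *
      volume (ball (0 : EuclideanSpace ℂ (Fin n)) 3) *
        ENNReal.ofReal (δ ^ ((n : ℝ) + 1 + α))) := by
    rw [hvol, hB, ← mul_assoc, ← ENNReal.ofReal_mul (by positivity), hexp,
      ENNReal.ofReal_mul hδ0.le, ENNReal.ofReal_mul (by positivity)]
    ring
  rw [hBK, hHint] at hmain
  exact (ENNReal.mul_le_mul_iff_right (by simpa using hδ0) ENNReal.ofReal_ne_top).1 hmain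

theorem exists_lintegral_carlesonRegion_le {n : ℕ} (hn : 1 ≤ n) {α : ℝ} (hα : -1 < α) :
    ∃ C : ENNReal, C ≠ ⊤ ∧ ∀ ζ : EuclideanSpace ℂ (Fin n), ‖ζ‖ = 1 → ∀ δ : ℝ, 0 < δ →
      ∫⁻ z in carlesonRegion ζ δ, bergmanWeight α z ≤
        C * ENNReal.ofReal (δ ^ ((n : ℝ) + 1 + α)) := by
  have hM : 0 < (n : ℝ) + 1 + α := by have := Nat.cast_nonneg (α := ℝ) n; linarith
  set C1 : ENNReal := ENNReal.ofReal (2 ^ |α| / (α + 1)) *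
    volume (ball (0 : EuclideanSpace ℂ (Fin n)) 3) with hC1
  set m : ENNReal := ∫⁻ z in (cBall n), bergmanWeight α z with hm
  refine ⟨C1 + m * ENNReal.ofReal (2 ^ ((n : ℝ) + 1 + α)), ?_, fun ζ hζ δ hδ => ?_⟩
  · refine ENNReal.add_ne_top.2 ⟨ENNReal.mul_ne_top ENNReal.ofReal_ne_top measure_ball_lt_top.ne,
      ENNReal.mul_ne_top (lintegral_bergmanWeight_lt_top hn hα).ne ENNReal.ofReal_ne_top⟩
  rcases le_total δ (1 / 2) with h | h
  · refine (lintegral_carlesonRegion_le_of_le_half hζ hα hδ h).trans ?_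
    gcongr
    exact le_self_add
  -- For $\delta\ge 1/2$ the total mass suffices, since $(2\delta)^{n+1+\alpha}\ge 1$.
  · calc _ ≤ m := lintegral_mono_set fun z hz => by simpa using hz.1
      _ ≤ m * ENNReal.ofReal (2 ^ ((n : ℝ) + 1 + α)) * ENNReal.ofReal (δ ^ ((n : ℝ) + 1 + α)) := by
        rw [mul_assoc, ← ENNReal.ofReal_mul (by positivity),
          ← Real.mul_rpow (by norm_num) hδ.le]
        refine le_mul_of_one_le_right zero_le (ENNReal.one_le_ofReal.2 ?_)
        exact Real.one_le_rpow (by linarith) hM.le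
      _ ≤ _ := by gcongr; exact le_add_self

/-! ### Kernel integrals by dyadic decomposition -/

/-- The Forelli–Rudin type upper estimate used for the test functions. -/
theorem exists_lintegral_kernel_le {n : ℕ} (hn : 1 ≤ n) {α : ℝ} (hα : -1 < α) :
    ∃ C : ENNReal, C ≠ ⊤ ∧ ∀ a ∈ cBall n,
      ∫⁻ z in cBall n, ENNReal.ofReal (‖1 - inner ℂ a z‖ ^ (-(2 * ((n : ℝ) + 1 + α)))) *
        bergmanWeight α z ≤ C * ENNReal.ofReal ((1 - ‖a‖) ^ (-((n : ℝ) + 1 + α))) := by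
  obtain ⟨C, hC, hCr⟩ := exists_lintegral_carlesonRegion_le hn hα
  set M : ℝ := (n : ℝ) + 1 + α with hMd
  have hM : 0 < M := by have := Nat.cast_nonneg (α := ℝ) n; linarith
  set q : ℝ := 2 ^ (-M) with hq
  have hq0 : 0 < q := by positivity
  have hq1 : q < 1 := Real.rpow_lt_one_of_one_lt_of_neg (by norm_num) (by linarith)
  refine ⟨ENNReal.ofReal (4 ^ M) * C * (1 - ENNReal.ofReal q)⁻¹, ?_, fun a ha => ?_⟩
  · refine ENNReal.mul_ne_top (ENNReal.mul_ne_top ENNReal.ofReal_ne_top hC)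
      (ENNReal.inv_ne_top.2 ?_)
    exact (tsub_pos_iff_lt.2 (by simpa using hq1)).ne'
  obtain ⟨ζ, hζ, haζ⟩ := exists_norm_eq_one_smul_eq hn a
  have hr1 : ‖a‖ < 1 := by simpa using ha
  set δ := 1 - ‖a‖ with hδ
  have hδ0 : 0 < δ := by linarith
  have hinner : ∀ z, inner ℂ a z = (‖a‖ : ℂ) * inner ℂ ζ z := fun z => by
    conv_lhs => rw [haζ]
    rw [inner_smul_left, Complex.conj_ofReal]
  have hlow : ∀ z ∈ cBall n, δ ≤ ‖1 - inner ℂ a z‖ := fun z hz => by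
    have h1 : ‖z‖ < 1 := by simpa using hz
    have h2 := norm_inner_le_norm (𝕜 := ℂ) a z
    have h3 := norm_sub_norm_le (1 : ℂ) (inner ℂ a z)
    rw [norm_one] at h3
    nlinarith [norm_nonneg a]
  -- Replacing $a$ by its direction $\zeta$ changes the inner product by at most $\delta\le\rho$,
  -- which doubles the radius.
  have hreg : ∀ z ∈ cBall n, ∀ ρ, δ ≤ ρ → ‖1 - inner ℂ a z‖ < ρ →
      z ∈ carlesonRegion ζ (2 * ρ) := fun z hz ρ hρ hlt => by
    have h1 : ‖z‖ < 1 := by simpa using hz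
    refine ⟨h1, ?_⟩
    have e : 1 - inner ℂ ζ z = (1 - inner ℂ a z) - ((δ : ℝ) : ℂ) * inner ℂ ζ z := by
      rw [hinner, hδ]; push_cast; ring
    have h2 := norm_inner_le_of_norm_eq_one hζ z
    rw [e]
    refine (norm_sub_le _ _).trans_lt ?_
    rw [norm_mul, Complex.norm_real, Real.norm_eq_abs, abs_of_pos hδ0]
    nlinarith
  -- `u k` dominates the integrand on the shell $2^k\delta\le|1-\langle z,a\rangle|<2^{k+1}\delta$.
  -- Its integral is at most a constant times $(2^k\delta)^{-2M}(4\cdot 2^k\delta)^M$, a geometric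
  -- sequence of ratio $2^{-M}$.
  set u : ℕ → EuclideanSpace ℂ (Fin n) → ENNReal := fun k =>
    (carlesonRegion ζ (2 * (2 ^ (k + 1) * δ))).indicator fun z =>
      ENNReal.ofReal ((2 ^ k * δ) ^ (-(2 * M))) * bergmanWeight α z with hu
  have hum : ∀ k, Measurable (u k) := fun k =>
    ((measurable_bergmanWeight α).const_mul _).indicator (measurableSet_carlesonRegion _ _)
  have hpt : ∀ z ∈ cBall n, ENNReal.ofReal (‖1 - inner ℂ a z‖ ^ (-(2 * M))) * bergmanWeight α z ≤
      ∑' k, u k z := fun z hz => by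
    obtain ⟨k, hk1, hk2⟩ := exists_nat_pow_near ((one_le_div hδ0).2 (hlow z hz)) one_lt_two
    rw [le_div_iff₀ hδ0] at hk1
    rw [div_lt_iff₀ hδ0] at hk2
    refine le_trans ?_ (ENNReal.le_tsum k)
    have hmem : z ∈ carlesonRegion ζ (2 * (2 ^ (k + 1) * δ)) :=
      hreg z hz _ (le_mul_of_one_le_left hδ0.le (one_le_pow₀ one_le_two)) hk2
    rw [hu]
    simp only [Set.indicator_of_mem hmem]
    gcongr ENNReal.ofReal ?_ * _
    exact Real.rpow_le_rpow_of_nonpos (by positivity) hk1 (by linarith)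
  have hterm : ∀ k, ∫⁻ z, u k z ≤
      ENNReal.ofReal (4 ^ M) * C * ENNReal.ofReal (δ ^ (-M)) * ENNReal.ofReal q ^ k := fun k => by
    rw [hu]
    simp only
    rw [lintegral_indicator (measurableSet_carlesonRegion _ _),
      lintegral_const_mul' _ _ ENNReal.ofReal_ne_top]
    have hexp : (2 ^ k * δ) ^ (-(2 * M)) * (2 * (2 ^ (k + 1) * δ)) ^ M =
        4 ^ M * (δ ^ (-M) * q ^ k) := by
      have e : 2 * (2 ^ (k + 1) * δ) = 4 * (2 ^ k * δ) := by ring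
      have e2 : (2 ^ k * δ) ^ (-(2 * M)) * (2 ^ k * δ) ^ M = (2 ^ k * δ) ^ (-M) := by
        rw [← Real.rpow_add (by positivity)]; ring_nf
      have e3 : ((2 : ℝ) ^ k) ^ (-M) = q ^ k := by
        rw [hq, ← Real.rpow_natCast, ← Real.rpow_natCast, ← Real.rpow_mul (by norm_num),
          ← Real.rpow_mul (by norm_num), mul_comm]
      rw [e, Real.mul_rpow (x := 4) (y := 2 ^ k * δ) (by norm_num) (by positivity), mul_left_comm, e2,
        Real.mul_rpow (by positivity) hδ0.le, e3, mul_comm (q ^ k)]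
    calc _ ≤ ENNReal.ofReal ((2 ^ k * δ) ^ (-(2 * M))) *
          (C * ENNReal.ofReal ((2 * (2 ^ (k + 1) * δ)) ^ M)) := by
          gcongr; exact hCr ζ hζ _ (by positivity)
      _ = C * ENNReal.ofReal ((2 ^ k * δ) ^ (-(2 * M)) * (2 * (2 ^ (k + 1) * δ)) ^ M) := by
          rw [ENNReal.ofReal_mul (by positivity)]; ring
      _ = _ := by
          rw [hexp, ENNReal.ofReal_mul (by positivity), ENNReal.ofReal_mul (by positivity),
            ENNReal.ofReal_pow hq0.le]
          ring
  calc _ ≤ ∫⁻ z in cBall n, ∑' k, u k z := setLIntegral_mono' measurableSet_ball hpt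
    _ ≤ ∫⁻ z, ∑' k, u k z := setLIntegral_le_lintegral _ _
    _ = ∑' k, ∫⁻ z, u k z := lintegral_tsum fun k => (hum k).aemeasurable
    _ ≤ ∑' k, ENNReal.ofReal (4 ^ M) * C * ENNReal.ofReal (δ ^ (-M)) * ENNReal.ofReal q ^ k :=
      ENNReal.tsum_le_tsum hterm
    _ = _ := by rw [ENNReal.tsum_mul_left, ENNReal.tsum_geometric]; ring

/-! ### Growth spaces: the cases $\lambda=0$, $\lambda<0$ and $\lambda>0$ -/

/-- The functions with `‖g z‖ ≤ C (1 - |z|)^{-lam}`. -/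
def growthSpace (n : ℕ) (lam : ℝ) : Set (Hol n) :=
  {g | ∃ C : ℝ, 0 ≤ C ∧
    ∀ z ∈ cBall n, ‖extZero g.1 z‖ ≤ C * (1 - ‖z‖) ^ (-lam)}

theorem differentiableOn_extZero {n : ℕ} (f : Hol n) : DifferentiableOn ℂ (extZero f.1) (cBall n) :=
  f.2

theorem differentiableAt_extZero {n : ℕ} (f : Hol n) {z : EuclideanSpace ℂ (Fin n)}
    (hz : z ∈ cBall n) : DifferentiableAt ℂ (extZero f.1) z :=
  (differentiableOn_extZero f z hz).differentiableAt (isOpen_ball.mem_nhds hz)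

theorem hol_ext_of_ball {n : ℕ} {f g : Hol n}
    (h : ∀ z ∈ cBall n, extZero f.1 z = extZero g.1 z) : f = g := by
  refine Subtype.ext (funext fun z => ?_)
  simpa [extZero_apply] using h z z.2

theorem growthSpace_zero (n : ℕ) : growthSpace n 0 = HInfty n := by
  ext g
  constructor
  · rintro ⟨C, -, h⟩
    refine ⟨C, ?_⟩
    rintro _ ⟨z, rfl⟩
    simpa [extZero_apply] using h z z.2
  · rintro ⟨C, h⟩
    refine ⟨max C 0, le_max_right _ _, fun z hz => ?_⟩
    have := h ⟨⟨z, hz⟩, rfl⟩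
    simpa [extZero_of_mem _ hz] using Or.inl this

/-- By the maximum principle $|g(z)|$ is at most the bound on the sphere of radius $r$, which tends
to $0$ as $r\to1$. -/
theorem growthSpace_of_neg {n : ℕ} (hn : 1 ≤ n) {lam : ℝ} (hlam : lam < 0) :
    growthSpace n lam = {0} := by
  have : Nonempty (Fin n) := ⟨⟨0, hn⟩⟩
  ext g
  rw [Set.mem_singleton_iff]
  constructor
  · rintro ⟨C, hC, h⟩
    refine hol_ext_of_ball fun z hz => ?_
    have h0 : extZero (0 : Hol n).1 z = 0 := by rw [extZero_of_mem _ hz]; rfl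
    rw [h0, ← norm_le_zero_iff]
    have hz1 : ‖z‖ < 1 := by simpa using hz
    have hbound : ∀ r ∈ Set.Ioo ‖z‖ 1, ‖extZero g.1 z‖ ≤ C * (1 - r) ^ (-lam) := by
      rintro r ⟨hr, hr1⟩
      have hr0 : 0 < r := (norm_nonneg z).trans_lt hr
      refine Complex.norm_le_of_forall_mem_frontier_norm_le (isBounded_ball (x := 0) (r := r))
        ?_ (fun w hw => ?_) (subset_closure (by simpa using hr))
      · refine DifferentiableOn.diffContOnCl ((differentiableOn_extZero g).mono ?_)
        rw [closure_ball _ hr0.ne']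
        exact closedBall_subset_ball hr1
      · rw [frontier_ball _ hr0.ne', mem_sphere_zero_iff_norm] at hw
        have := h w (by rw [mem_ball_zero_iff, hw]; exact hr1)
        rwa [hw] at this
    have hlim : Filter.Tendsto (fun r : ℝ => C * (1 - r) ^ (-lam)) (nhdsWithin 1 (Set.Iio 1))
        (nhds 0) := by
      have hc : Continuous fun r : ℝ => C * (1 - r) ^ (-lam) :=
        continuous_const.mul ((continuous_const.sub continuous_id).rpow_const
          fun _ => Or.inr (by linarith))
      have := (hc.tendsto 1).mono_left (nhdsWithin_le_nhds (s := Set.Iio 1))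
      simpa [Real.zero_rpow (neg_pos.2 hlam).ne'] using this
    refine ge_of_tendsto hlim ?_
    filter_upwards [Ioo_mem_nhdsLT hz1] with r hr using hbound r hr
  · rintro rfl
    refine ⟨0, le_rfl, fun z hz => ?_⟩
    have h0 : extZero (0 : Hol n).1 z = 0 := by rw [extZero_of_mem _ hz]; rfl
    rw [h0]; simp

theorem radialDeriv_eq_fderiv {n : ℕ} (f : Hol n) (z : cBall n) :
    radialDeriv f z = fderiv ℂ (extZero f.1) z z := by
  have h : (z : EuclideanSpace ℂ (Fin n)) = ∑ j, (z : EuclideanSpace ℂ (Fin n)) j •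
      EuclideanSpace.single j (1 : ℂ) := by
    ext i
    simp [Finset.sum_apply, Pi.single_apply]
  conv_rhs => rw [h, map_sum]
  simp only [map_smul, smul_eq_mul, ← h]
  rfl

theorem mem_blochSpace_iff {n : ℕ} (f : Hol n) (lam : ℝ) : f ∈ BlochSpace n (lam + 1) ↔
    ∃ K : ℝ, 0 ≤ K ∧ ∀ z ∈ cBall n,
      ‖fderiv ℂ (extZero f.1) z z‖ ≤ K * (1 - ‖z‖) ^ (-lam - 1) := by
  have key : ∀ (K : ℝ) (z : cBall n), (1 - ‖(z : EuclideanSpace ℂ (Fin n))‖) * ‖radialDeriv f z‖ /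
      (1 - ‖(z : EuclideanSpace ℂ (Fin n))‖) ^ (1 - (lam + 1)) ≤ K ↔
      ‖fderiv ℂ (extZero f.1) z z‖ ≤ K * (1 - ‖(z : EuclideanSpace ℂ (Fin n))‖) ^ (-lam - 1) := by
    intro K z
    have hz : ‖(z : EuclideanSpace ℂ (Fin n))‖ < 1 := mem_ball_zero_iff.1 z.2
    have ht : 0 < 1 - ‖(z : EuclideanSpace ℂ (Fin n))‖ := by linarith
    rw [radialDeriv_eq_fderiv, show 1 - (lam + 1) = -lam - 1 + 1 by ring, Real.rpow_add ht,
      Real.rpow_one, mul_comm (_ ^ _), mul_div_mul_left _ _ ht.ne',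
      div_le_iff₀ (Real.rpow_pos_of_pos ht _)]
  constructor
  · rintro ⟨K, hK⟩
    refine ⟨max K 0, le_max_right _ _, fun z hz => ?_⟩
    exact (key _ ⟨z, hz⟩).1 ((hK ⟨⟨z, hz⟩, rfl⟩).trans (le_max_left _ _))
  · rintro ⟨K, -, hK⟩
    refine ⟨K, ?_⟩
    rintro _ ⟨z, rfl⟩
    exact (key K z).2 (hK z z.2)

/-- $Rg(z)$ is the derivative at $c=1$ of $c\mapsto g(cz)$. Cauchy's estimate applies on the disc of
radius $(1-|z|)/2$ about $1$, where $1-|cz|\ge(1-|z|)/2$. -/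
theorem growthSpace_subset_blochSpace {n : ℕ} {lam : ℝ} (hlam : 0 < lam) :
    growthSpace n lam ⊆ BlochSpace n (lam + 1) := by
  rintro g ⟨C, hC, h⟩
  refine (mem_blochSpace_iff g lam).2 ⟨C * (1 / 2) ^ (-lam) * 2, by positivity, fun z hz => ?_⟩
  have hz1 : ‖z‖ < 1 := by simpa using hz
  set t := 1 - ‖z‖ with ht
  have ht0 : 0 < t := by linarith
  have hnorm : ∀ c ∈ closedBall (1 : ℂ) (t / 2), ‖c • z‖ ≤ 1 - t / 2 := fun c hc => by
    have h1 : ‖c‖ ≤ 1 + t / 2 := by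
      have := norm_le_norm_add_norm_sub' c 1
      rw [norm_one] at this
      rw [mem_closedBall_iff_norm] at hc
      linarith
    rw [norm_smul]
    nlinarith [norm_nonneg z]
  have hmem : ∀ c ∈ closedBall (1 : ℂ) (t / 2), c • z ∈ cBall n := fun c hc => by
    rw [mem_ball_zero_iff]; linarith [hnorm c hc]
  have hd : DifferentiableOn ℂ (fun c : ℂ => extZero g.1 (c • z)) (closedBall 1 (t / 2)) :=
    (differentiableOn_extZero g).comp (by fun_prop) hmem
  have hderiv : HasDerivAt (fun c : ℂ => extZero g.1 (c • z)) (fderiv ℂ (extZero g.1) z z) 1 := by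
    have h1 : HasFDerivAt (extZero g.1) (fderiv ℂ (extZero g.1) z) ((1 : ℂ) • z) := by
      rw [one_smul]; exact (differentiableAt_extZero g hz).hasFDerivAt
    have h2 : HasDerivAt (fun c : ℂ => c • z) z 1 := by
      simpa using (hasDerivAt_id (1 : ℂ)).smul_const z
    exact h1.comp_hasDerivAt 1 h2
  rw [← hderiv.deriv]
  have hle := Complex.norm_deriv_le_of_forall_mem_sphere_norm_le (half_pos ht0)
    (DifferentiableOn.diffContOnCl (by rwa [closure_ball _ (half_pos ht0).ne']))
    (C := C * (t / 2) ^ (-lam)) fun c hc => by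
      have hc' := sphere_subset_closedBall hc
      refine (h _ (hmem c hc')).trans ?_
      gcongr ?_ * ?_
      exact Real.rpow_le_rpow_of_nonpos (half_pos ht0) (by linarith [hnorm c hc']) (by linarith)
  refine hle.trans_eq ?_
  rw [Real.rpow_sub_one ht0.ne', div_eq_mul_one_div t 2, Real.mul_rpow ht0.le (by norm_num),
    div_eq_mul_inv _ (t * (1 / 2)), mul_inv, div_eq_mul_inv]
  ring

theorem hasDerivAt_one_sub_mul_rpow {lam b t : ℝ} (hlam : lam ≠ 0) (hb : b ≠ 0)
    (ht : 0 < 1 - t * b) (K : ℝ) :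
    HasDerivAt (fun t : ℝ => K / (lam * b) * (1 - t * b) ^ (-lam))
      (K * (1 - t * b) ^ (-lam - 1)) t := by
  have h1 : HasDerivAt (fun t : ℝ => 1 - t * b) (-b) t := by
    simpa using ((hasDerivAt_id t).mul_const b).const_sub 1
  refine ((h1.rpow_const (p := -lam) (Or.inl ht.ne')).const_mul (K / (lam * b))).congr_deriv ?_
  generalize (1 - t * b) ^ (-lam - 1) = x
  field_simp

/-- Radial integration from $z/2$ to $z$, in the form of a mean value inequality with the majorant
of `hasDerivAt_one_sub_mul_rpow`. Small $z$ are handled by compactness, so $1/|z|\le 2$ in the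
remaining case. -/
theorem blochSpace_subset_growthSpace {n : ℕ} {lam : ℝ} (hlam : 0 < lam) :
    BlochSpace n (lam + 1) ⊆ growthSpace n lam := by
  intro g hg
  obtain ⟨K, hK, h⟩ := (mem_blochSpace_iff g lam).1 hg
  obtain ⟨S, hS⟩ := (isCompact_closedBall (0 : EuclideanSpace ℂ (Fin n)) (1 / 2)).exists_bound_of_continuousOn
    ((differentiableOn_extZero g).continuousOn.mono (closedBall_subset_ball (by norm_num)))
  have hS0 : 0 ≤ S := (norm_nonneg _).trans (hS 0 (by simp))
  refine ⟨S + 2 * K / (lam * (1 / 2)), by positivity, fun z hz => ?_⟩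
  have hz1 : ‖z‖ < 1 := by simpa using hz
  have hone : 1 ≤ (1 - ‖z‖) ^ (-lam) :=
    Real.one_le_rpow_of_pos_of_le_one_of_nonpos (by linarith) (by linarith [norm_nonneg z])
      (by linarith)
  have hSle : S ≤ S * (1 - ‖z‖) ^ (-lam) := le_mul_of_one_le_right hS0 hone
  rcases le_total ‖z‖ (1 / 2) with hz2 | hz2
  · refine (hS z (by simpa using hz2)).trans (hSle.trans ?_)
    gcongr
    exact le_add_of_nonneg_right (by positivity)
  have hz0 : 0 < ‖z‖ := by linarith
  set φ : ℝ → ℂ := fun t => extZero g.1 (t • z) with hφ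
  have hmem : ∀ t ∈ Set.Icc (1 / 2 : ℝ) 1, ‖t • z‖ = t * ‖z‖ ∧ t * ‖z‖ < 1 := fun t ht => by
    refine ⟨by rw [norm_smul, Real.norm_of_nonneg (by linarith [ht.1])], ?_⟩
    nlinarith [ht.2]
  have hderiv : ∀ t ∈ Set.Icc (1 / 2 : ℝ) 1,
      HasDerivAt φ (fderiv ℂ (extZero g.1) (t • z) z) t := fun t ht => by
    have hm : t • z ∈ cBall n := by
      rw [mem_ball_zero_iff, (hmem t ht).1]; exact (hmem t ht).2
    have h1 := (differentiableAt_extZero g hm).hasFDerivAt.restrictScalars ℝ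
    have h2 : HasDerivAt (fun t : ℝ => t • z) z t := by
      simpa using (hasDerivAt_id t).smul_const z
    exact h1.comp_hasDerivAt t h2
  have hbd : ∀ t ∈ Set.Icc (1 / 2 : ℝ) 1,
      ‖fderiv ℂ (extZero g.1) (t • z) z‖ ≤ 2 * K * (1 - t * ‖z‖) ^ (-lam - 1) := fun t ht => by
    obtain ⟨e1, e2⟩ := hmem t ht
    have h1 := h (t • z) (by rw [mem_ball_zero_iff, e1]; exact e2)
    -- The Bloch condition bounds $Rg(tz)$, which is $t$ times the derivative along $z$; starting at
    -- $t=1/2$ makes the division by $t$ cost only a factor $2$.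
    have e3 : fderiv ℂ (extZero g.1) (t • z) (t • z) =
        (t : ℂ) * fderiv ℂ (extZero g.1) (t • z) z := by
      conv_lhs => rw [← Complex.coe_smul t z, map_smul, smul_eq_mul]
      rw [Complex.coe_smul]
    rw [e3, norm_mul, Complex.norm_real, Real.norm_of_nonneg (by linarith [ht.1]), e1] at h1
    have := ht.1
    nlinarith [norm_nonneg (fderiv ℂ (extZero g.1) (t • z) z)]
  have hB := fun (t : ℝ) (ht : t ∈ Set.Icc (1 / 2 : ℝ) 1) =>
    hasDerivAt_one_sub_mul_rpow hlam.ne' hz0.ne' (sub_pos.2 (hmem t ht).2) (2 * K)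
  have hmv := image_norm_le_of_norm_deriv_right_le_deriv_boundary'
    (f := fun t => φ t - φ (1 / 2)) (a := 1 / 2) (b := 1)
    (f' := fun t => fderiv ℂ (extZero g.1) (t • z) z)
    (fun t ht => ((hderiv t ht).continuousAt.sub continuousAt_const).continuousWithinAt)
    (fun t ht => ((hderiv t ⟨ht.1, ht.2.le⟩).sub_const _).hasDerivWithinAt)
    (B := fun t => 2 * K / (lam * ‖z‖) * (1 - t * ‖z‖) ^ (-lam))
    (by
      have : 0 ≤ 1 - 1 / 2 * ‖z‖ := by linarith
      simp only [sub_self, norm_zero]; positivity)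
    (fun t ht => (hB t ht).continuousAt.continuousWithinAt)
    (fun t ht => (hB t ⟨ht.1, ht.2.le⟩).hasDerivWithinAt)
    (fun t ht => hbd t ⟨ht.1, ht.2.le⟩) (Set.right_mem_Icc.2 (by norm_num))
  simp only [hφ, one_smul, one_mul] at hmv
  have hhalf : ‖extZero g.1 ((1 / 2 : ℝ) • z)‖ ≤ S := by
    refine hS _ ?_
    rw [mem_closedBall_zero_iff, (hmem (1 / 2) (by norm_num)).1]
    linarith
  calc ‖extZero g.1 z‖ ≤ ‖extZero g.1 ((1 / 2 : ℝ) • z)‖ +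
        ‖extZero g.1 z - extZero g.1 ((1 / 2 : ℝ) • z)‖ := norm_le_norm_add_norm_sub' _ _
    _ ≤ S * (1 - ‖z‖) ^ (-lam) + 2 * K / (lam * ‖z‖) * (1 - ‖z‖) ^ (-lam) :=
      add_le_add (hhalf.trans hSle) hmv
    _ ≤ S * (1 - ‖z‖) ^ (-lam) + 2 * K / (lam * (1 / 2)) * (1 - ‖z‖) ^ (-lam) := by gcongr
    _ = _ := by ring

theorem growthSpace_eq_blochSpace {n : ℕ} {lam : ℝ} (hlam : 0 < lam) :
    growthSpace n lam = BlochSpace n (lam + 1) :=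
  (growthSpace_subset_blochSpace hlam).antisymm (blochSpace_subset_growthSpace hlam)

/-! ### Bergman norms as integrals, and sufficiency of the growth condition -/

theorem extZero_eq_indicator {n : ℕ} (f : cBall n → ℂ) :
    extZero f = (cBall n).indicator (extZero f) := by
  funext z
  by_cases hz : z ∈ cBall n
  · rw [Set.indicator_of_mem hz]
  · rw [Set.indicator_of_notMem hz, extZero,
      Function.extend_apply' _ _ _ (by rintro ⟨y, rfl⟩; exact hz y.2), Pi.zero_apply]

theorem measurable_extZero {n : ℕ} (f : Hol n) : Measurable (extZero f.1) := by
  classical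
  rw [extZero_eq_indicator, ← Set.piecewise_eq_indicator]
  exact ContinuousOn.measurable_piecewise (differentiableOn_extZero f).continuousOn
    continuousOn_const measurableSet_ball

theorem extZero_mul {n : ℕ} (f g : Hol n) {z : EuclideanSpace ℂ (Fin n)} (hz : z ∈ cBall n) :
    extZero (f * g).1 z = extZero f.1 z * extZero g.1 z := by
  simp only [extZero_of_mem _ hz]; rfl

theorem lintegral_bergmanMeasure {n : ℕ} (α : ℝ) {G : EuclideanSpace ℂ (Fin n) → ENNReal}
    (hG : Measurable G) : ∫⁻ z, G z ∂bergmanMeasure n α =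
      (∫⁻ z in cBall n, bergmanWeight α z)⁻¹ * ∫⁻ z in cBall n, G z * bergmanWeight α z := by
  have h : bergmanMeasure n α = (∫⁻ z in cBall n, bergmanWeight α z)⁻¹ •
    (volume.restrict (cBall n)).withDensity (bergmanWeight α) := rfl
  rw [h, lintegral_smul_measure, smul_eq_mul,
    lintegral_withDensity_eq_lintegral_mul _ (measurable_bergmanWeight α) hG]
  simp only [Pi.mul_apply, mul_comm]

theorem eLpNorm_extZero_eq {n : ℕ} {p : ℝ} (hp : 0 < p) (α : ℝ) (f : Hol n) :
    eLpNorm (extZero f.1) (ENNReal.ofReal p) (bergmanMeasure n α) =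
      (∫⁻ z, ‖extZero f.1 z‖ₑ ^ p ∂bergmanMeasure n α) ^ (1 / p) := by
  rw [eLpNorm_eq_lintegral_rpow_enorm_toReal (by simpa using hp) ENNReal.ofReal_ne_top,
    ENNReal.toReal_ofReal hp.le]

theorem bergmanNorm_nonneg {n : ℕ} (p α : ℝ) (f : Hol n) : 0 ≤ bergmanNorm p α f :=
  ENNReal.toReal_nonneg

theorem lintegral_eq_bergmanNorm_rpow {n : ℕ} {p : ℝ} (hp : 0 < p) {α : ℝ} {f : Hol n}
    (hf : f ∈ BergmanSpace n p α) : ∫⁻ z, ‖extZero f.1 z‖ₑ ^ p ∂bergmanMeasure n α =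
      ENNReal.ofReal (bergmanNorm p α f ^ p) := by
  rw [← ENNReal.ofReal_rpow_of_nonneg (bergmanNorm_nonneg p α f) hp.le, bergmanNorm,
    ENNReal.ofReal_toReal hf.eLpNorm_ne_top, eLpNorm_extZero_eq hp, ← ENNReal.rpow_mul,
    one_div_mul_cancel hp.ne', ENNReal.rpow_one]

theorem mem_bergmanSpace_and_norm_le {n : ℕ} {p : ℝ} (hp : 0 < p) {α : ℝ} {f : Hol n} {B : ℝ}
    (hB : 0 ≤ B)
    (h : ∫⁻ z, ‖extZero f.1 z‖ₑ ^ p ∂bergmanMeasure n α ≤ ENNReal.ofReal (B ^ p)) :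
    f ∈ BergmanSpace n p α ∧ bergmanNorm p α f ≤ B := by
  have hle : eLpNorm (extZero f.1) (ENNReal.ofReal p) (bergmanMeasure n α) ≤ ENNReal.ofReal B := by
    rw [eLpNorm_extZero_eq hp]
    refine (ENNReal.rpow_le_rpow h (by positivity)).trans_eq ?_
    rw [ENNReal.ofReal_rpow_of_nonneg (by positivity) (by positivity), ← Real.rpow_mul hB,
      mul_one_div_cancel hp.ne', Real.rpow_one]
  exact ⟨⟨(measurable_extZero f).aestronglyMeasurable, hle.trans_lt ENNReal.ofReal_lt_top⟩,
    ENNReal.toReal_le_of_le_ofReal hB hle⟩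

theorem enorm_rpow_eq_ofReal {p : ℝ} (hp : 0 ≤ p) (w : ℂ) :
    ‖w‖ₑ ^ p = ENNReal.ofReal (‖w‖ ^ p) := by
  rw [← ofReal_norm, ENNReal.ofReal_rpow_of_nonneg (norm_nonneg _) hp]

theorem exists_norm_le_bergmanNorm {n : ℕ} (hn : 1 ≤ n) {p : ℝ} (hp : 0 < p) {α : ℝ}
    (hα : -1 < α) : ∃ C : ℝ, 0 ≤ C ∧ ∀ f ∈ BergmanSpace n p α, ∀ a ∈ cBall n,
      ‖extZero f.1 a‖ ≤ C * bergmanNorm p α f * (1 - ‖a‖) ^ (-(((n : ℝ) + 1 + α) / p)) := by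
  obtain ⟨C, hC, h⟩ := exists_pointEval_le hn hp α
  set m := ∫⁻ z in cBall n, bergmanWeight α z with hm
  have hm0 : m ≠ 0 := lintegral_bergmanWeight_ne_zero n α
  have hmt : m ≠ ⊤ := (lintegral_bergmanWeight_lt_top hn hα).ne
  have hCm : C * m ≠ ⊤ := ENNReal.mul_ne_top hC hmt
  refine ⟨(C * m).toReal ^ (1 / p), by positivity, fun f hf a ha => ?_⟩
  have ha1 : ‖a‖ < 1 := by simpa using ha
  have ht : 0 < 1 - ‖a‖ := by linarith
  have h1 := h (extZero f.1) (differentiableOn_extZero f) a ha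
  have h2 := lintegral_eq_bergmanNorm_rpow hp hf
  rw [lintegral_bergmanMeasure α ((measurable_extZero f).enorm.pow_const p)] at h2
  have h3 : ∫⁻ z in cBall n, ‖extZero f.1 z‖ₑ ^ p * bergmanWeight α z =
      m * ENNReal.ofReal (bergmanNorm p α f ^ p) := by
    rw [← h2, ← mul_assoc, ENNReal.mul_inv_cancel hm0 hmt, one_mul]
  have hN := bergmanNorm_nonneg p α f
  rw [h3, ← mul_assoc, ← ENNReal.ofReal_toReal hCm, enorm_rpow_eq_ofReal hp.le,
    ← ENNReal.ofReal_mul (by positivity), ← ENNReal.ofReal_mul (by positivity),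
    ENNReal.ofReal_le_ofReal_iff (by positivity)] at h1
  have h4 := Real.rpow_le_rpow (by positivity) h1 (one_div_nonneg.2 hp.le)
  rw [Real.mul_rpow (by positivity) (by positivity), Real.mul_rpow (by positivity) (by positivity),
    ← Real.rpow_mul hN, ← Real.rpow_mul (norm_nonneg _), ← Real.rpow_mul ht.le,
    mul_one_div_cancel hp.ne', Real.rpow_one, Real.rpow_one, mul_one_div] at h4
  rwa [Real.rpow_neg ht.le, ← div_eq_mul_inv, le_div_iff₀ (by positivity), mul_comm]

/-- Exchanges powers of $1-|z|$ for powers of $1-|z|^2$: their ratio $1+|z|$ lies in $[1,2]$. -/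
theorem one_sub_rpow_mul_le {t γ α β : ℝ} (h : γ = α - β) (ht0 : 0 ≤ t) (ht1 : t < 1) :
    (1 - t) ^ γ * (1 - t ^ 2) ^ β ≤ 2 ^ |γ| * (1 - t ^ 2) ^ α := by
  have h1 : 0 < 1 - t := by linarith
  have e : 1 - t ^ 2 = (1 - t) * (1 + t) := by ring
  have h2 : (1 - t ^ 2) ^ α = (1 - t) ^ γ * (1 + t) ^ γ * (1 - t ^ 2) ^ β := by
    have h3 : 0 < 1 - t ^ 2 := by rw [e]; positivity
    rw [← Real.mul_rpow h1.le (by linarith), ← e, ← Real.rpow_add h3, h]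
    ring_nf
  have h4 : 1 ≤ 2 ^ |γ| * (1 + t) ^ γ := by
    have h5 : (1 + t) ^ (-γ) ≤ 2 ^ |γ| :=
      calc (1 + t) ^ (-γ) ≤ (1 + t) ^ |γ| :=
            Real.rpow_le_rpow_of_exponent_le (by linarith) (neg_le_abs γ)
        _ ≤ 2 ^ |γ| := Real.rpow_le_rpow (by linarith) (by linarith) (abs_nonneg γ)
    rwa [Real.rpow_neg (by linarith), inv_le_iff_one_le_mul₀ (by positivity)] at h5
  rw [h2]
  have h6 : 0 ≤ (1 - t) ^ γ * (1 - t ^ 2) ^ β := by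
    refine mul_nonneg (by positivity) (Real.rpow_nonneg ?_ _); rw [e]; positivity
  nlinarith

theorem growthSpace_subset_bergmanMultipliers {n : ℕ} (hn : 1 ≤ n) {p q α β lam : ℝ} (hp : 0 < p)
    (hpq : p ≤ q) (hα : -1 < α)
    (hlam : lam = ((n : ℝ) + 1 + β) / q - ((n : ℝ) + 1 + α) / p) :
    growthSpace n lam ⊆ BergmanMultipliers n p α q β := by
  rintro g ⟨Cg, hCg, hg⟩
  have hq : 0 < q := hp.trans_le hpq
  obtain ⟨C, hC, hev⟩ := exists_norm_le_bergmanNorm hn hp hα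
  set mα := ∫⁻ z in cBall n, bergmanWeight α z with hmα
  set mβ := ∫⁻ z in cBall n, bergmanWeight β z with hmβ
  have hmα0 : mα ≠ 0 := lintegral_bergmanWeight_ne_zero n α
  have hmαt : mα ≠ ⊤ := (lintegral_bergmanWeight_lt_top hn hα).ne
  have hmβ0 : mβ ≠ 0 := lintegral_bergmanWeight_ne_zero n β
  set R : ℝ := (mβ⁻¹ * mα).toReal with hR
  have hRt : mβ⁻¹ * mα ≠ ⊤ := ENNReal.mul_ne_top (ENNReal.inv_ne_top.2 hmβ0) hmαt
  have hR0 : 0 ≤ R := ENNReal.toReal_nonneg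
  set K : ℝ := C ^ (q - p) * Cg ^ q * 2 ^ |α - β| with hK
  have hK0 : 0 ≤ K := by positivity
  -- The added $1$ keeps the constant positive, as $K$ can vanish.
  refine ⟨(R * K) ^ (1 / q) + 1, by positivity, fun f hf => ?_⟩
  set N := bergmanNorm p α f with hN
  have hN0 : 0 ≤ N := bergmanNorm_nonneg p α f
  have hpt : ∀ z ∈ cBall n, ‖extZero (f * g).1 z‖ₑ ^ q * bergmanWeight β z ≤
      ENNReal.ofReal (K * N ^ (q - p)) * (‖extZero f.1 z‖ₑ ^ p * bergmanWeight α z) := by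
    intro z hz
    have hz1 : ‖z‖ < 1 := by simpa using hz
    have ht : 0 < 1 - ‖z‖ := by linarith
    have hf1 := hev f hf z hz
    have hg1 := hg z hz
    rw [extZero_mul f g hz, enorm_rpow_eq_ofReal hq.le, enorm_rpow_eq_ofReal hp.le, bergmanWeight,
      bergmanWeight, ← ENNReal.ofReal_mul (by positivity), ← ENNReal.ofReal_mul (by positivity),
      ← ENNReal.ofReal_mul (by positivity)]
    refine ENNReal.ofReal_le_ofReal ?_
    have hw : ∀ γ : ℝ, 0 ≤ (1 - ‖z‖ ^ 2) ^ γ := fun γ =>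
      Real.rpow_nonneg (by nlinarith [norm_nonneg z]) γ
    have hsplit : ‖extZero f.1 z‖ ^ q = ‖extZero f.1 z‖ ^ p * ‖extZero f.1 z‖ ^ (q - p) := by
      rw [← Real.rpow_add_of_nonneg (norm_nonneg _) hp.le (by linarith)]; ring_nf
    have hA : ‖extZero f.1 z‖ ^ (q - p) ≤ C ^ (q - p) * N ^ (q - p) *
        (1 - ‖z‖) ^ (-(((n : ℝ) + 1 + α) / p) * (q - p)) := by
      rw [Real.rpow_mul ht.le, ← Real.mul_rpow hC hN0, ← Real.mul_rpow (by positivity)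
        (by positivity)]
      exact Real.rpow_le_rpow (norm_nonneg _) hf1 (by linarith)
    have hB : ‖extZero g.1 z‖ ^ q ≤ Cg ^ q * (1 - ‖z‖) ^ (-lam * q) := by
      rw [Real.rpow_mul ht.le, ← Real.mul_rpow hCg (by positivity)]
      exact Real.rpow_le_rpow (norm_nonneg _) hg1 hq.le
    -- This balance of exponents is what determines $\lambda$.
    have hexp : -(((n : ℝ) + 1 + α) / p) * (q - p) + -lam * q = α - β := by
      rw [hlam]; field_simp; ring
    calc ‖extZero f.1 z * extZero g.1 z‖ ^ q * (1 - ‖z‖ ^ 2) ^ β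
        = ‖extZero f.1 z‖ ^ p * ‖extZero f.1 z‖ ^ (q - p) * ‖extZero g.1 z‖ ^ q *
          (1 - ‖z‖ ^ 2) ^ β := by
          rw [norm_mul, Real.mul_rpow (norm_nonneg _) (norm_nonneg _), hsplit]
      _ ≤ ‖extZero f.1 z‖ ^ p * (C ^ (q - p) * N ^ (q - p) *
          (1 - ‖z‖) ^ (-(((n : ℝ) + 1 + α) / p) * (q - p))) * (Cg ^ q * (1 - ‖z‖) ^ (-lam * q)) *
          (1 - ‖z‖ ^ 2) ^ β := by
          have := hw β
          gcongr
      _ = C ^ (q - p) * Cg ^ q * N ^ (q - p) * ‖extZero f.1 z‖ ^ p *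
          ((1 - ‖z‖) ^ (α - β) * (1 - ‖z‖ ^ 2) ^ β) := by
          rw [← hexp, Real.rpow_add ht]; ring
      _ ≤ C ^ (q - p) * Cg ^ q * N ^ (q - p) * ‖extZero f.1 z‖ ^ p *
          (2 ^ |α - β| * (1 - ‖z‖ ^ 2) ^ α) := by
          exact mul_le_mul_of_nonneg_left (one_sub_rpow_mul_le rfl (norm_nonneg z) hz1)
            (by positivity)
      _ = _ := by rw [hK]; ring
  have hint : ∫⁻ z, ‖extZero (f * g).1 z‖ₑ ^ q ∂bergmanMeasure n β ≤
      ENNReal.ofReal (((R * K) ^ (1 / q) * N) ^ q) := by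
    have hf2 := lintegral_eq_bergmanNorm_rpow hp hf
    rw [lintegral_bergmanMeasure α ((measurable_extZero f).enorm.pow_const p)] at hf2
    have hf3 : ∫⁻ z in cBall n, ‖extZero f.1 z‖ₑ ^ p * bergmanWeight α z =
        mα * ENNReal.ofReal (N ^ p) := by
      rw [hN, ← hf2, ← mul_assoc, ENNReal.mul_inv_cancel hmα0 hmαt, one_mul]
    rw [lintegral_bergmanMeasure β ((measurable_extZero (f * g)).enorm.pow_const q)]
    calc _ ≤ mβ⁻¹ * ∫⁻ z in cBall n, ENNReal.ofReal (K * N ^ (q - p)) *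
          (‖extZero f.1 z‖ₑ ^ p * bergmanWeight α z) := by
          exact mul_le_mul' le_rfl (setLIntegral_mono' measurableSet_ball hpt)
      _ = mβ⁻¹ * mα * ENNReal.ofReal (K * N ^ (q - p)) * ENNReal.ofReal (N ^ p) := by
          rw [lintegral_const_mul' _ _ ENNReal.ofReal_ne_top, hf3]; ring
      _ = ENNReal.ofReal (R * (K * N ^ (q - p)) * N ^ p) := by
          rw [← ENNReal.ofReal_toReal hRt, ← ENNReal.ofReal_mul hR0,
            ← ENNReal.ofReal_mul (by positivity)]
      _ = _ := by
          congr 1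
          have e : N ^ (q - p) * N ^ p = N ^ q := by
            rw [← Real.rpow_add_of_nonneg hN0 (by linarith) hp.le]; ring_nf
          rw [Real.mul_rpow (by positivity) hN0, ← Real.rpow_mul (by positivity),
            one_div_mul_cancel hq.ne', Real.rpow_one, ← e]
          ring
  obtain ⟨h1, h2⟩ := mem_bergmanSpace_and_norm_le hq (by positivity) hint
  exact ⟨h1, h2.trans (by gcongr; linarith)⟩

/-! ### Test functions and necessity of the growth condition -/

/-- The test function `(1 - ⟨z, a⟩)^{-s}`. -/
noncomputable def kernelPower {n : ℕ} (a : EuclideanSpace ℂ (Fin n)) (ha : a ∈ cBall n) (s : ℝ) :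
    Hol n :=
  ⟨fun z => (1 - inner ℂ a (z : EuclideanSpace ℂ (Fin n))) ^ (-(s : ℂ)), by
    have h : DifferentiableOn ℂ (fun z => (1 - inner ℂ a z) ^ (-(s : ℂ))) (cBall n) := by
      -- The base has positive real part on the ball, so the principal branch of the power is
      -- holomorphic there.
      refine DifferentiableOn.cpow_const ?_ fun z hz => Or.inl ?_
      · exact ((innerSL ℂ a).differentiable.const_sub 1).differentiableOn
      · have h1 : ‖a‖ < 1 := by simpa using ha
        have h2 : ‖z‖ < 1 := by simpa using hz
        have h3 := (Complex.re_le_norm _).trans (norm_inner_le_norm (𝕜 := ℂ) a z)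
        rw [Complex.sub_re, Complex.one_re]
        nlinarith [norm_nonneg a, norm_nonneg z]
    exact h.congr fun z hz => by rw [extZero_of_mem _ hz]⟩

theorem norm_kernelPower {n : ℕ} {a : EuclideanSpace ℂ (Fin n)} (ha : a ∈ cBall n) (s : ℝ)
    {z : EuclideanSpace ℂ (Fin n)} (hz : z ∈ cBall n) :
    ‖extZero (kernelPower a ha s).1 z‖ = ‖1 - inner ℂ a z‖ ^ (-s) := by
  have h1 : ‖a‖ < 1 := by simpa using ha
  have h2 : ‖z‖ < 1 := by simpa using hz
  have h3 := norm_inner_le_norm (𝕜 := ℂ) a z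
  have h0 : 1 - inner ℂ a z ≠ 0 := by
    intro h
    have : ‖inner ℂ a z‖ = 1 := by rw [← sub_eq_zero.1 h, norm_one]
    nlinarith [norm_nonneg a, norm_nonneg z]
  rw [extZero_of_mem _ hz]
  change ‖(1 - inner ℂ a z) ^ (-(s : ℂ))‖ = _
  rw [← Complex.ofReal_neg, Complex.norm_cpow_of_ne_zero h0]
  simp

/-- The exponent is chosen so that the $p$-th power of the modulus is the kernel of
`exists_lintegral_kernel_le`. -/
theorem exists_bergmanNorm_kernelPower_le {n : ℕ} (hn : 1 ≤ n) {p : ℝ} (hp : 0 < p) {α : ℝ}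
    (hα : -1 < α) : ∃ C : ℝ, 0 ≤ C ∧ ∀ a (ha : a ∈ cBall n),
      kernelPower a ha (2 * ((n : ℝ) + 1 + α) / p) ∈ BergmanSpace n p α ∧
      bergmanNorm p α (kernelPower a ha (2 * ((n : ℝ) + 1 + α) / p)) ≤
        C * (1 - ‖a‖) ^ (-(((n : ℝ) + 1 + α) / p)) := by
  obtain ⟨C, hC, h⟩ := exists_lintegral_kernel_le hn hα
  set m := ∫⁻ z in cBall n, bergmanWeight α z with hm
  have hm0 : m ≠ 0 := lintegral_bergmanWeight_ne_zero n α
  have hCm : m⁻¹ * C ≠ ⊤ := ENNReal.mul_ne_top (ENNReal.inv_ne_top.2 hm0) hC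
  refine ⟨(m⁻¹ * C).toReal ^ (1 / p), by positivity, fun a ha => ?_⟩
  have ha1 : ‖a‖ < 1 := by simpa using ha
  have ht : 0 < 1 - ‖a‖ := by linarith
  refine mem_bergmanSpace_and_norm_le hp (by positivity) ?_
  rw [lintegral_bergmanMeasure α ((measurable_extZero _).enorm.pow_const p)]
  calc _ ≤ m⁻¹ * (C * ENNReal.ofReal ((1 - ‖a‖) ^ (-((n : ℝ) + 1 + α)))) := by
        gcongr
        refine le_trans (le_of_eq ?_) (h a ha)
        refine setLIntegral_congr_fun measurableSet_ball fun z hz => ?_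
        rw [enorm_rpow_eq_ofReal hp.le, norm_kernelPower ha _ hz, ← Real.rpow_mul (norm_nonneg _)]
        congr 3
        field_simp
    _ = ENNReal.ofReal ((m⁻¹ * C).toReal * (1 - ‖a‖) ^ (-((n : ℝ) + 1 + α))) := by
        rw [← mul_assoc, ENNReal.ofReal_mul (by positivity), ENNReal.ofReal_toReal hCm]
    _ = _ := by
        rw [Real.mul_rpow (by positivity) (by positivity), ← Real.rpow_mul (by positivity),
          ← Real.rpow_mul ht.le, one_div_mul_cancel hp.ne', Real.rpow_one, neg_mul,
          div_mul_cancel₀ _ hp.ne']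

/-- At its own centre the test function has modulus at least $(2(1-|a|))^{-s}$. Dividing the point
evaluation bound for $k_ag$ at $a$ by this leaves $(1-|a|)$ to the power
$-M_\alpha/p-M_\beta/q+2M_\alpha/p=-\lambda$. -/
theorem bergmanMultipliers_subset_growthSpace {n : ℕ} (hn : 1 ≤ n) {p q α β lam : ℝ} (hp : 0 < p)
    (hq : 0 < q) (hα : -1 < α) (hβ : -1 < β)
    (hlam : lam = ((n : ℝ) + 1 + β) / q - ((n : ℝ) + 1 + α) / p) :
    BergmanMultipliers n p α q β ⊆ growthSpace n lam := by
  rintro g ⟨C, hC, hmul⟩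
  obtain ⟨C₁, hC₁, hev⟩ := exists_norm_le_bergmanNorm hn hq hβ
  obtain ⟨C₂, hC₂, htest⟩ := exists_bergmanNorm_kernelPower_le hn hp hα
  set s : ℝ := 2 * ((n : ℝ) + 1 + α) / p with hs
  have hs0 : 0 ≤ s := by
    have := Nat.cast_nonneg (α := ℝ) n
    have : 0 ≤ (n : ℝ) + 1 + α := by linarith
    positivity
  refine ⟨C₁ * (C * C₂) * 2 ^ s, by positivity, fun a ha => ?_⟩
  have ha1 : ‖a‖ < 1 := by simpa using ha
  have ht : 0 < 1 - ‖a‖ := by linarith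
  obtain ⟨hk1, hk2⟩ := htest a ha
  obtain ⟨h1, h2⟩ := hmul _ hk1
  have h3 := hev _ h1 a ha
  rw [extZero_mul _ _ ha, norm_mul, norm_kernelPower ha _ ha, Real.rpow_neg (norm_nonneg _),
    inv_mul_eq_div] at h3
  have hin : ‖1 - inner ℂ a a‖ ≤ 2 * (1 - ‖a‖) := by
    have e : 1 - inner ℂ a a = ((1 - ‖a‖ ^ 2 : ℝ) : ℂ) := by
      rw [inner_self_eq_norm_sq_to_K]; push_cast; rfl
    rw [e, Complex.norm_real, Real.norm_of_nonneg] <;> nlinarith [norm_nonneg a]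
  have hin0 : 0 < ‖1 - inner ℂ a a‖ := by
    have h4 := norm_inner_le_norm (𝕜 := ℂ) a a
    have h5 := norm_sub_norm_le (1 : ℂ) (inner ℂ a a)
    rw [norm_one] at h5
    nlinarith [norm_nonneg a]
  rw [div_le_iff₀ (by positivity)] at h3
  calc ‖extZero g.1 a‖ ≤ _ := h3
    _ ≤ C₁ * (C * (C₂ * (1 - ‖a‖) ^ (-(((n : ℝ) + 1 + α) / p)))) *
        (1 - ‖a‖) ^ (-(((n : ℝ) + 1 + β) / q)) * (2 * (1 - ‖a‖)) ^ s := by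
        gcongr
        exact h2.trans (by gcongr)
    _ = C₁ * (C * C₂) * 2 ^ s * ((1 - ‖a‖) ^ (-(((n : ℝ) + 1 + α) / p)) *
        (1 - ‖a‖) ^ (-(((n : ℝ) + 1 + β) / q)) * (1 - ‖a‖) ^ s) := by
        rw [Real.mul_rpow (by norm_num) ht.le]; ring
    _ = _ := by
        rw [← Real.rpow_add ht, ← Real.rpow_add ht, hlam, hs]
        congr 2
        ring

theorem bergmanMultipliers_eq_growthSpace {n : ℕ} (hn : 1 ≤ n) {p q α β lam : ℝ} (hp : 0 < p)
    (hpq : p ≤ q) (hα : -1 < α) (hβ : -1 < β)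
    (hlam : lam = ((n : ℝ) + 1 + β) / q - ((n : ℝ) + 1 + α) / p) :
    BergmanMultipliers n p α q β = growthSpace n lam :=
  (bergmanMultipliers_subset_growthSpace hn hp (hp.trans_le hpq) hα hβ hlam).antisymm
    (growthSpace_subset_bergmanMultipliers hn hp hpq hα hlam)

theorem mainTheorem5 (n : ℕ) (hn : 1 ≤ n) (p q α β lam : ℝ) (hp : 0 < p) (hpq : p ≤ q)
    (hα : -1 < α) (hβ : -1 < β)
    (hlam : lam = ((n : ℝ) + 1 + β) / q - ((n : ℝ) + 1 + α) / p) :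
    (0 < lam → BergmanMultipliers n p α q β = BlochSpace n (lam + 1)) ∧
    (lam = 0 → BergmanMultipliers n p α q β = HInfty n) ∧
    (lam < 0 → BergmanMultipliers n p α q β = {0}) := by
  rw [bergmanMultipliers_eq_growthSpace hn hp hpq hα hβ hlam]
  refine ⟨growthSpace_eq_blochSpace, ?_, growthSpace_of_neg hn⟩
  rintro h
  rw [h, growthSpace_zero]
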